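/- **Model.** Let $a\ge 1$ and $d\ge 2$. For $i=1,\dots,a$ and $k=1,2,\dots$ let $X_{ik}=\mu_i+\epsilon_{ik}$ be independent random vectors in $\mathbb R^d$, where $\mu_i\in\mathbb R^d$ and, for each $i$, the residuals $\epsilon_{i1},\epsilon_{i2},\dots$ are i.i.d. with $\mathbb E(\epsilon_{i1})=0$, $\mathbb E\|\epsilon_{i1}\|^4<\infty$ and covariance matrix $V_i$ with positive diagonal entries. Group $i$ consists of $X_{i1},\dots,X_{in_i}$, and $N=\sum_{i=1}^a n_i$. Assume (A1): $n_i\to\infty$ and $n_i/N\to\kappa_i>0$ for all $i$ (so $\kappa_i\in(0,1)$ if $a\ge2$). **Notation.** $\operatorname{vech}$ and $\operatorname{vech}^-$ list row-wise the upper triangular entries of a $d\times d$ matrix with, respectively without, the diagonal; $p=d(d+1)/2$ and $p_u=d(d-1)/2$. For a vector $v\in\mathbb R^p$ indexed by the pairs $j\le k$ and $r\in\mathbb R^{p_u}$ indexed by the pairs $j<k$ put $$M(v,r)=\Big[L-\tfrac12\operatorname{diag}(r)M_1\Big]\operatorname{diag}\big(\operatorname{vech}(v_0^\top v_0)\big)^{-1/2},\qquad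 v_0=(v_{11},\dots,v_{dd}),$$ where $L,M_1\in\mathbb R^{p_u\times p}$, the row of $L$ with index $(j,k)$ is the unit vector $e_{(j,k)}^\top$, and the row of $M_1$ with index $(j,k)$ is $e_{(k,k)}^\top+e_{(j,j)}^\top$. Let $R_i$ be the correlation matrix belonging to $V_i$, $v_i=\operatorname{vech}(V_i)$, $r_i=\operatorname{vech}^-(R_i)$, $\Sigma_i=\operatorname{Cov}(\operatorname{vech}(\epsilon_{i1}\epsilon_{i1}^\top))$, and $$\Upsilon_i=M(v_i,r_i)\,\Sigma_i\,M(v_i,r_i)^\top,\qquad \Upsilon=\bigoplus_{i=1}^a\kappa_i^{-1}\Upsilon_i .$$ Let $\widehat V_i$ be the empirical covariance matrix of $X_{i1},\dots,X_{in_i}$ (with factor $(n_i-1)^{-1}$), $\widehat R_i$ the empirical correlation matrix, $\widehat v_i=\operatorname{vech}(\widehat V_i)$, $\widehat r_i=\operatorname{vech}^-(\widehat R_i)$ and $\widetilde X_{ik}=X_{ik}-\overline X_i$. (Where an empirical variance vanishes, the undefined reciprocals are set to $0$.) **Wild bootstrap.** Let the weights $W_{ik}$ be independent, independent of the data, identically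 distributed within each group, with $\mathbb E(W_{i1})=0$ and $\operatorname{Var}(W_{i1})=1$. Put $$Y^\star_{ik}=W_{ik}\,M(\widehat v_i,\widehat r_i)\Big[\operatorname{vech}(\widetilde X_{ik}\widetilde X_{ik}^\top)-n_i^{-1}\sum_{\ell=1}^{n_i}\operatorname{vech}(\widetilde X_{i\ell}\widetilde X_{i\ell}^\top)\Big],$$ $\overline Y^\star_i=n_i^{-1}\sum_{k=1}^{n_i}Y^\star_{ik}$ and $\overline Y^\star=(\overline Y_1^{\star\top},\dots,\overline Y_a^{\star\top})^\top$. Let $\widehat\Upsilon_i^\star$ be the empirical covariance matrix of $Y^\star_{i1},\dots,Y^\star_{in_i}$ (with factor $(n_i-1)^{-1}$) and $\widehat\Upsilon^\star=\bigoplus_{i=1}^a\frac{N}{n_i}\widehat\Upsilon^\star_i$. **Claim.** The following hold. (a) For each $i=1,\dots,a$, the conditional distribution of $\sqrt N\,\overline Y^\star_i$ given the data $(X_{jk})_{j\le a,\,k\le n_j}$ converges weakly to $\mathcal N_{p_u}(0,\kappa_i^{-1}\Upsilon_i)$ in probability. (b) The conditional distribution of $\sqrt N\,\overline Y^\star$ given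 the data converges weakly to $\mathcal N_{ap_u}(0,\Upsilon)$ in probability. Moreover, $\widehat\Upsilon_i^\star\to\Upsilon_i$ in probability for each $i$, and $\widehat\Upsilon^\star\to\Upsilon$ in probability. Here the conditional distributions converge weakly to $\nu$ in probability if, for every bounded continuous $f$, the conditional expectation of $f$ of the vector given the data converges in probability to $\int f\,d\nu$. -/

import Mathlib

open MeasureTheory ProbabilityTheory Filter Topology
open scoped Matrix BoundedContinuousFunction

noncomputable section

namespace WildBootstrap

/-- Positions of the upper triangular entries, diagonal included, of a `d × d` matrix. There are
`p = d (d + 1) / 2` of them; a vector in `ℝ ^ p` is indexed by these pairs (in their row-wise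
enumeration) rather than by `1, …, p`. -/
abbrev VechIdx (d : ℕ) : Type := {q : Fin d × Fin d // q.1 ≤ q.2}

/-- Positions of the strictly upper triangular entries; there are `p_u = d (d - 1) / 2` of them. -/
abbrev UpIdx (d : ℕ) : Type := {q : Fin d × Fin d // q.1 < q.2}

/-- Half-vectorization `vech`. -/
def vech {d : ℕ} (A : Matrix (Fin d) (Fin d) ℝ) : VechIdx d → ℝ :=
  fun q => A q.1.1 q.1.2

/-- Upper-half-vectorization `vech⁻`. -/
def vechUp {d : ℕ} (A : Matrix (Fin d) (Fin d) ℝ) : UpIdx d → ℝ :=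
  fun q => A q.1.1 q.1.2

/-- The position of the `j`-th diagonal entry in the half-vectorization. -/
def diagPos {d : ℕ} (j : Fin d) : VechIdx d := ⟨(j, j), le_rfl⟩

/-- The position of an off-diagonal entry in the half-vectorization. -/
def offDiagPos {d : ℕ} (q : UpIdx d) : VechIdx d := ⟨q.1, le_of_lt q.2⟩

/-- The matrix `L_p^u`: the row at `q` is the unit vector at the position of `q` within `vech`,
so that `L_p^u vech(A) = vech⁻(A)`. -/
def elimUp (d : ℕ) : Matrix (UpIdx d) (VechIdx d) ℝ :=
  Matrix.of fun q => Pi.single (offDiagPos q) 1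

/-- The matrix `M₁`: the row at `(j, k)`, `j < k`, is the sum of the unit vectors at the positions
of the diagonal entries `(k, k)` and `(j, j)` within `vech`. -/
def matM1 (d : ℕ) : Matrix (UpIdx d) (VechIdx d) ℝ :=
  Matrix.of fun q => Pi.single (diagPos q.1.2) 1 + Pi.single (diagPos q.1.1) 1

/-- The matrix `M(v, r) = [L_p^u - ½ diag(r) M₁] diag(vech(v₀ᵀ v₀)) ^ (-½)` where
`v₀ = (v₁₁, …, v_dd)` is the row vector of the variances contained in `v`. -/
def matM {d : ℕ} (v : VechIdx d → ℝ) (r : UpIdx d → ℝ) : Matrix (UpIdx d) (VechIdx d) ℝ :=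
  (elimUp d - (1 / 2 : ℝ) • (Matrix.diagonal r * matM1 d)) *
    Matrix.diagonal (fun q =>
      vech (Matrix.vecMulVec (fun j => v (diagPos j)) (fun j => v (diagPos j))) q
        ^ (-(1 / 2) : ℝ))

/-- Correlation matrix belonging to a covariance matrix. -/
def corrMatrix {d : ℕ} (V : Matrix (Fin d) (Fin d) ℝ) : Matrix (Fin d) (Fin d) ℝ :=
  Matrix.of fun j k => V j k / Real.sqrt (V j j * V k k)

/-- `M(vech(V), vech⁻(R))` for a covariance matrix `V` with correlation matrix `R`. -/
def matMOfCov {d : ℕ} (V : Matrix (Fin d) (Fin d) ℝ) : Matrix (UpIdx d) (VechIdx d) ℝ :=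
  matM (vech V) (vechUp (corrMatrix V))

/-- Covariance matrix of a random vector. -/
def covMatrix {Ω ι : Type*} [MeasurableSpace Ω] (P : Measure Ω) (Z : Ω → ι → ℝ) :
    Matrix ι ι ℝ :=
  Matrix.of fun p q => cov[fun ω => Z ω p, fun ω => Z ω q; P]

/-- `Υ = M(v, r) Σ M(v, r)ᵀ` for a residual vector `e`, where `v`, `r` are the vectorized
covariance and correlation matrices of `e` and `Σ = Cov(vech(e eᵀ))`. -/
def upsilon {Ω : Type*} [MeasurableSpace Ω] {d : ℕ} (P : Measure Ω) (e : Ω → Fin d → ℝ) :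
    Matrix (UpIdx d) (UpIdx d) ℝ :=
  matMOfCov (covMatrix P e) * covMatrix P (fun ω => vech (Matrix.vecMulVec (e ω) (e ω))) *
    (matMOfCov (covMatrix P e))ᵀ

/-- Sample mean. -/
def sampleMean {ι : Type*} {n : ℕ} (x : Fin n → ι → ℝ) : ι → ℝ :=
  (n : ℝ)⁻¹ • ∑ k, x k

/-- Empirical covariance matrix. -/
def sampleCov {ι : Type*} {n : ℕ} (x : Fin n → ι → ℝ) : Matrix ι ι ℝ :=
  ((n : ℝ) - 1)⁻¹ • ∑ k, Matrix.vecMulVec (x k - sampleMean x) (x k - sampleMean x)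

/-- `vech(X̃ₖ X̃ₖᵀ)` with `X̃ₖ = Xₖ - X̄`. -/
def vechResid {d n : ℕ} (x : Fin n → Fin d → ℝ) (k : Fin n) : VechIdx d → ℝ :=
  vech (Matrix.vecMulVec (x k - sampleMean x) (x k - sampleMean x))

/-- The wild bootstrap sample
`Y⋆ₖ = Wₖ M(v̂, r̂) [vech(X̃ₖ X̃ₖᵀ) - n⁻¹ ∑ₗ vech(X̃ₗ X̃ₗᵀ)]` of one group. -/
def wildSample {d n : ℕ} (x : Fin n → Fin d → ℝ) (w : Fin n → ℝ) (k : Fin n) : UpIdx d → ℝ :=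
  w k • (matMOfCov (sampleCov x) *ᵥ (vechResid x k - sampleMean (vechResid x)))

/-- Given the data `S m`, the conditional distribution of `T m` converges weakly to `ν`, in
probability: for each bounded continuous `f`, the integral of `f` with respect to the (regular)
conditional distribution of `T m` given `S m` converges in probability to `∫ f dν`. -/
def CondTendstoWeakly {Ω E : Type*} [MeasurableSpace Ω] (P : Measure Ω) [IsFiniteMeasure P]
    [TopologicalSpace E] [MeasurableSpace E] [StandardBorelSpace E] [Nonempty E]
    {D : ℕ → Type*} [∀ m, MeasurableSpace (D m)] (S : ∀ m, Ω → D m) (T : ℕ → Ω → E)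
    (ν : Measure E) : Prop :=
  ∀ f : E →ᵇ ℝ, TendstoInMeasure P
    (fun m ω => ∫ y, f y ∂(condDistrib (T m) (S m) P (S m ω))) atTop
    (fun _ => ∫ y, f y ∂ν)

section Model

variable {Ω : Type*} {a d : ℕ}

/-- The data set `X_ik = μ_i + ε_ik`, `i = 1, …, a`, `k = 1, …, n_i`. -/
def dataSet (μ : Fin a → Fin d → ℝ) (ε : Fin a → ℕ → Ω → Fin d → ℝ) (n : Fin a → ℕ) (ω : Ω) :
    (i : Fin a) → Fin (n i) → Fin d → ℝ :=
  fun i k => μ i + ε i k ω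

/-- The wild bootstrap sample `Y⋆_i1, …, Y⋆_in_i` of group `i`. -/
def wildGroup (μ : Fin a → Fin d → ℝ) (ε : Fin a → ℕ → Ω → Fin d → ℝ) (W : Fin a → ℕ → Ω → ℝ)
    (n : Fin a → ℕ) (i : Fin a) (ω : Ω) : Fin (n i) → UpIdx d → ℝ :=
  wildSample (dataSet μ ε n ω i) (fun k => W i k ω)

/-- The total sample size `N`. -/
def total (n : Fin a → ℕ) : ℕ := ∑ i, n i

/-- `√N Ȳ⋆_i`. -/
def scaledGroupMean (μ : Fin a → Fin d → ℝ) (ε : Fin a → ℕ → Ω → Fin d → ℝ)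
    (W : Fin a → ℕ → Ω → ℝ) (n : Fin a → ℕ) (i : Fin a) (ω : Ω) : EuclideanSpace ℝ (UpIdx d) :=
  WithLp.toLp 2 (Real.sqrt (total n) • sampleMean (wildGroup μ ε W n i ω))

/-- `√N Ȳ⋆`, where `Ȳ⋆` stacks `Ȳ⋆_1, …, Ȳ⋆_a`. -/
def scaledPooledMean (μ : Fin a → Fin d → ℝ) (ε : Fin a → ℕ → Ω → Fin d → ℝ)
    (W : Fin a → ℕ → Ω → ℝ) (n : Fin a → ℕ) (ω : Ω) : EuclideanSpace ℝ (UpIdx d × Fin a) :=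
  WithLp.toLp 2 (fun q => Real.sqrt (total n) * sampleMean (wildGroup μ ε W n q.2 ω) q.1)

/-- The group-wise estimator: the empirical covariance matrix of `Y⋆_i1, …, Y⋆_in_i`. -/
def upsilonStar (μ : Fin a → Fin d → ℝ) (ε : Fin a → ℕ → Ω → Fin d → ℝ)
    (W : Fin a → ℕ → Ω → ℝ) (n : Fin a → ℕ) (i : Fin a) (ω : Ω) :
    Matrix (UpIdx d) (UpIdx d) ℝ :=
  sampleCov (wildGroup μ ε W n i ω)

/-- The pooled estimator: the direct sum of the `N / n_i` multiples of the group-wise ones. -/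
def upsilonStarPooled (μ : Fin a → Fin d → ℝ) (ε : Fin a → ℕ → Ω → Fin d → ℝ)
    (W : Fin a → ℕ → Ω → ℝ) (n : Fin a → ℕ) (ω : Ω) :
    Matrix (UpIdx d × Fin a) (UpIdx d × Fin a) ℝ :=
  Matrix.blockDiagonal fun i => ((total n : ℝ) / (n i : ℝ)) • upsilonStar μ ε W n i ω

/-- `Υ`, the direct sum of the matrices `κ_i⁻¹ Υ_i`. -/
def upsilonPooled [MeasurableSpace Ω] (P : Measure Ω) (ε : Fin a → ℕ → Ω → Fin d → ℝ)
    (κ : Fin a → ℝ) : Matrix (UpIdx d × Fin a) (UpIdx d × Fin a) ℝ :=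
  Matrix.blockDiagonal fun i => (κ i)⁻¹ • upsilon P (ε i 0)

end Model

end WildBootstrap

end

/-! Once the data are frozen, the bootstrap mean is a linear combination of the weights `W i k` with
deterministic vector coefficients, so by independence its conditional law is the law of that
combination (`integral_condDistrib_of_indepFun`). A central limit theorem for such sums
(`tendsto_integral_sum_smul`) needs two facts in every direction `t`: the squared coefficients sum
to a limit, and the largest coefficient tends to zero. There are only finitely many weight laws, all
standardized, so nothing else is needed in place of a Lindeberg condition.

Both facts are deterministic along a data sequence obeying the law of large numbers for moments up
to order four (`IsTypical`). Each coefficient is a combination of products of coordinates of the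
residuals, with multipliers that depend on the sample size only and converge. The averages of
squares then converge to the quadratic form of `upsilon`, and negligibility follows because
convergent averages of `f k ^ 2` force `f k ^ 2 / k → 0` (`rowNegligible_of_tendsto_cesaro`).

The strong law makes almost every sample typical (`ae_isTypical`), so the conditional laws converge
almost surely, hence in probability. The covariance estimators are handled by the same expansion,
now with the weights `W` and `W ^ 2` inside the strong law (`ae_momentLLN`). -/

noncomputable section

namespace WildBootstrap

/-! ### Central limit theorem for weighted sums of standardized variables. -/

section CLT

/-- Factors are exchanged one at a time; the remaining ones have norm at most one and do not enlarge
the error. -/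
theorem norm_prod_sub_prod_le_sum {J : Type*} (s : Finset J) (f g : J → ℂ)
    (hf : ∀ j ∈ s, ‖f j‖ ≤ 1) (hg : ∀ j ∈ s, ‖g j‖ ≤ 1) :
    ‖∏ j ∈ s, f j - ∏ j ∈ s, g j‖ ≤ ∑ j ∈ s, ‖f j - g j‖ := by
  classical
  induction s using Finset.induction_on with
  | empty => simp
  | insert b s hb ih =>
    rw [Finset.prod_insert hb, Finset.prod_insert hb, Finset.sum_insert hb]
    have ih' := ih (fun j hj => hf j (Finset.mem_insert_of_mem hj))
      (fun j hj => hg j (Finset.mem_insert_of_mem hj))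
    have h1 : ‖∏ j ∈ s, g j‖ ≤ 1 := by
      rw [norm_prod]
      exact Finset.prod_le_one (fun _ _ => norm_nonneg _)
        (fun j hj => hg j (Finset.mem_insert_of_mem hj))
    have h2 := hf b (Finset.mem_insert_self b s)
    calc ‖f b * ∏ j ∈ s, f j - g b * ∏ j ∈ s, g j‖
        = ‖f b * (∏ j ∈ s, f j - ∏ j ∈ s, g j) + (f b - g b) * ∏ j ∈ s, g j‖ := by
          congr 1; ring
      _ ≤ ‖f b‖ * ‖∏ j ∈ s, f j - ∏ j ∈ s, g j‖ + ‖f b - g b‖ * ‖∏ j ∈ s, g j‖ := by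
          rw [← norm_mul, ← norm_mul]; exact norm_add_le _ _
      _ ≤ 1 * ‖∏ j ∈ s, f j - ∏ j ∈ s, g j‖ + ‖f b - g b‖ * 1 := by gcongr
      _ ≤ _ := by linarith

/-- `X` and the standard Gaussian share their first two moments, hence the same second-order Taylor
expansion at `0`; subtracting the two expansions leaves the remainder. -/
theorem isLittleO_charFun_sub_exp {Ω : Type*} [MeasurableSpace Ω] {P : Measure Ω}
    [IsProbabilityMeasure P] {X : Ω → ℝ} (hX : AEMeasurable X P) (h0 : P[X] = 0)
    (h1 : P[X ^ 2] = 1) :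
    (fun t : ℝ => charFun (P.map X) t - Complex.exp (-(t : ℂ) ^ 2 / 2)) =o[𝓝 0] fun t => t ^ 2 := by
  have hG := taylor_charFun_two (P := gaussianReal 0 1) (X := id) aemeasurable_id
    (by simp) (by
      have := variance_eq_sub (μ := gaussianReal 0 1) (X := id) (memLp_id_gaussianReal 2)
      simpa using this.symm)
  refine ((taylor_charFun_two hX h0 h1).sub hG).congr_left fun t => ?_
  rw [Measure.map_id, charFun_gaussianReal]
  simp only [sub_sub_sub_cancel_right, sub_right_inj]
  congr 1
  push_cast
  ring

/-- Convergence of the product of the characteristic functions of a triangular array of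
multiples of standardized variables with square summable, uniformly small coefficients. -/
theorem tendsto_prod_charFun {J : Type*} (ν : J → Measure ℝ) [∀ j, IsProbabilityMeasure (ν j)]
    (hν : ∀ η > 0, ∃ δ > 0, ∀ j, ∀ t : ℝ, |t| ≤ δ →
      ‖charFun (ν j) t - Complex.exp (-(t : ℂ) ^ 2 / 2)‖ ≤ η * t ^ 2)
    (s : ℕ → Finset J) (c : ℕ → J → ℝ) (σ : ℝ)
    (hσ : Tendsto (fun m => ∑ j ∈ s m, c m j ^ 2) atTop (𝓝 σ))
    (hc : ∀ δ > 0, ∀ᶠ m in atTop, ∀ j ∈ s m, |c m j| ≤ δ) :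
    Tendsto (fun m => ∏ j ∈ s m, charFun (ν j) (c m j)) atTop
      (𝓝 (Complex.exp (-(σ : ℂ) / 2))) := by
  have hexp : Tendsto (fun m => ∏ j ∈ s m, Complex.exp (-(c m j : ℂ) ^ 2 / 2)) atTop
      (𝓝 (Complex.exp (-(σ : ℂ) / 2))) := by
    have h : Tendsto (fun m => Complex.exp (-((∑ j ∈ s m, c m j ^ 2 : ℝ) : ℂ) / 2)) atTop
        (𝓝 (Complex.exp (-(σ : ℂ) / 2))) :=
      ((by fun_prop : Continuous fun x : ℝ => Complex.exp (-(x : ℂ) / 2)).tendsto σ).comp hσ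
    refine h.congr fun m => ?_
    rw [← Complex.exp_sum]
    congr 1
    push_cast
    rw [← Finset.sum_div, Finset.sum_neg_distrib]
  have hdiff : Tendsto (fun m => ∏ j ∈ s m, charFun (ν j) (c m j) -
      ∏ j ∈ s m, Complex.exp (-(c m j : ℂ) ^ 2 / 2)) atTop (𝓝 0) := by
    rw [Metric.tendsto_nhds]
    intro r hr
    have hσ1 : ∀ᶠ m in atTop, ∑ j ∈ s m, c m j ^ 2 < |σ| + 1 :=
      hσ.eventually_lt_const (by linarith [le_abs_self σ])
    -- The accuracy is chosen so that multiplying by the sum of squares, eventually below `|σ| + 1`,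
    -- gives less than `r`.
    obtain ⟨δ, hδ, hδ'⟩ := hν (r / (|σ| + 1)) (by positivity)
    filter_upwards [hσ1, hc δ hδ] with m h1 h2
    rw [dist_zero_right]
    calc _ ≤ ∑ j ∈ s m, ‖charFun (ν j) (c m j) - Complex.exp (-(c m j : ℂ) ^ 2 / 2)‖ := by
          refine norm_prod_sub_prod_le_sum _ _ _ (fun j _ => norm_charFun_le_one _) fun j _ => ?_
          rw [Complex.norm_exp]
          refine Real.exp_le_one_iff.2 ?_
          have : (-(c m j : ℂ) ^ 2 / 2) = ((-(c m j) ^ 2 / 2 : ℝ) : ℂ) := by push_cast; ring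
          rw [this, Complex.ofReal_re]
          nlinarith [sq_nonneg (c m j)]
      _ ≤ ∑ j ∈ s m, r / (|σ| + 1) * c m j ^ 2 := Finset.sum_le_sum fun j hj => hδ' j _ (h2 j hj)
      _ = r / (|σ| + 1) * ∑ j ∈ s m, c m j ^ 2 := by rw [Finset.mul_sum]
      _ < r / (|σ| + 1) * (|σ| + 1) := by gcongr
      _ = r := by field_simp
  simpa using hdiff.add hexp

/-- By Lévy's continuity theorem one direction `t` at a time suffices, and there independence
factors the characteristic function into those of the weights at the scalars `inner ℝ (v m j) t`. -/
theorem tendsto_integral_sum_smul {Ω J ι : Type*} [MeasurableSpace Ω] (P : Measure Ω)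
    [IsProbabilityMeasure P] [Fintype ι] [DecidableEq ι] (W : J → Ω → ℝ)
    (hWm : ∀ j, Measurable (W j)) (hWi : iIndepFun W P)
    (hν : ∀ η > 0, ∃ δ > 0, ∀ j, ∀ t : ℝ, |t| ≤ δ →
      ‖charFun (P.map (W j)) t - Complex.exp (-(t : ℂ) ^ 2 / 2)‖ ≤ η * t ^ 2)
    (s : ℕ → Finset J) (v : ℕ → J → EuclideanSpace ℝ ι) (S : Matrix ι ι ℝ) (hS : S.PosSemidef)
    (hσ : ∀ t : EuclideanSpace ℝ ι, Tendsto (fun m => ∑ j ∈ s m, inner ℝ (v m j) t ^ 2) atTop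
      (𝓝 (t ⬝ᵥ S *ᵥ t)))
    (hc : ∀ t : EuclideanSpace ℝ ι, ∀ δ > 0, ∀ᶠ m in atTop, ∀ j ∈ s m, |inner ℝ (v m j) t| ≤ δ)
    (f : EuclideanSpace ℝ ι →ᵇ ℝ) :
    Tendsto (fun m => ∫ ω, f (∑ j ∈ s m, W j ω • v m j) ∂P) atTop
      (𝓝 (∫ y, f y ∂(multivariateGaussian 0 S))) := by
  have hprob : ∀ j, IsProbabilityMeasure (P.map (W j)) := fun j =>
    Measure.isProbabilityMeasure_map (hWm j).aemeasurable
  have hmeas : ∀ m, Measurable fun ω => ∑ j ∈ s m, W j ω • v m j := fun m =>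
    Finset.measurable_fun_sum _ fun j _ => (hWm j).smul_const _
  let μs : ℕ → ProbabilityMeasure (EuclideanSpace ℝ ι) := fun m =>
    ⟨P.map fun ω => ∑ j ∈ s m, W j ω • v m j,
      Measure.isProbabilityMeasure_map (hmeas m).aemeasurable⟩
  let γ : ProbabilityMeasure (EuclideanSpace ℝ ι) := ⟨multivariateGaussian 0 S, inferInstance⟩
  have key : Tendsto μs atTop (𝓝 γ) := by
    rw [ProbabilityMeasure.tendsto_iff_tendsto_charFun]
    intro t
    have hlim := tendsto_prod_charFun (fun j => P.map (W j)) hν s (fun m j => inner ℝ (v m j) t)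
      _ (hσ t) (hc t)
    have hγ : charFun (γ : Measure (EuclideanSpace ℝ ι)) t =
        Complex.exp (-((t ⬝ᵥ S *ᵥ t : ℝ) : ℂ) / 2) := by
      change charFun (multivariateGaussian 0 S) t = _
      rw [charFun_multivariateGaussian hS]
      congr 1
      simp
      ring
    rw [hγ]
    refine hlim.congr fun m => ?_
    change _ = charFun (P.map fun ω => ∑ j ∈ s m, W j ω • v m j) t
    have hind : iIndepFun (fun j ω => W j ω • v m j) P :=
      hWi.comp (fun j x => x • v m j) fun j => by fun_prop
    rw [iIndepFun.charFun_map_fun_finsetSum_eq_prod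
      (X := fun j ω => W j ω • v m j)
      (fun j _ => ((hWm j).smul_const _).aemeasurable) (hind.restrict _), Finset.prod_apply]
    refine Finset.prod_congr rfl fun j _ => ?_
    rw [charFun_apply, charFun_apply, integral_map (hWm j).aemeasurable (by fun_prop),
      integral_map ((hWm j).smul_const _).aemeasurable (by fun_prop)]
    refine integral_congr_ae (Eventually.of_forall fun ω => ?_)
    simp [inner_smul_left, mul_comm]
  have := (ProbabilityMeasure.tendsto_iff_forall_integral_tendsto.1 key) f
  refine this.congr fun m => ?_
  change ∫ x, f x ∂(P.map _) = _
  rw [integral_map (hmeas m).aemeasurable f.continuous.measurable.aestronglyMeasurable]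

end CLT

/-! ### Conditional laws under independence. -/

section Conditional

/-- Freezing: the kernel sending `x` to the law of `Φ (x, Z)` has the right joint law with `X`, by
Fubini for the product law of `(X, Z)`, and conditional distributions are almost surely unique. -/
theorem integral_condDistrib_of_indepFun {Ω D F E : Type*} [MeasurableSpace Ω]
    [MeasurableSpace D] [MeasurableSpace F] (P : Measure Ω) [IsProbabilityMeasure P]
    [TopologicalSpace E] [MeasurableSpace E] [StandardBorelSpace E] [Nonempty E]
    [OpensMeasurableSpace E]
    (X : Ω → D) (Z : Ω → F) (hX : Measurable X) (hZ : Measurable Z) (hXZ : IndepFun X Z P)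
    (Φ : D × F → E) (hΦ : Measurable Φ) (f : E →ᵇ ℝ) :
    ∀ᵐ ω ∂P, ∫ y, f y ∂(condDistrib (fun ω => Φ (X ω, Z ω)) X P (X ω)) =
      ∫ ω', f (Φ (X ω, Z ω')) ∂P := by
  have := Measure.isProbabilityMeasure_map (μ := P) hZ.aemeasurable
  let κ : Kernel D E := (Kernel.prod Kernel.id (Kernel.const D (P.map Z))).map Φ
  have hκ : ∀ x, κ x = P.map fun ω => Φ (x, Z ω) := by
    intro x
    rw [Kernel.map_apply _ hΦ, Kernel.prod_apply, Kernel.id_apply, Kernel.const_apply,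
      Measure.dirac_prod, Measure.map_map hΦ (by fun_prop), Measure.map_map (by fun_prop) hZ]
    rfl
  have h := condDistrib_ae_eq_of_measure_eq_compProd (μ := P) (Y := fun ω => Φ (X ω, Z ω)) X
    (hΦ.comp (hX.prodMk hZ)).aemeasurable (κ := κ) (by
      ext s hs
      have hs' : MeasurableSet {q : D × F | (q.1, Φ q) ∈ s} :=
        (measurable_fst.prodMk hΦ) hs
      rw [Measure.compProd_apply hs]
      have h1 : P.map (fun ω => (X ω, Φ (X ω, Z ω))) s =
          P.map (fun ω => (X ω, Z ω)) {q : D × F | (q.1, Φ q) ∈ s} := by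
        have hm : Measurable fun ω => (X ω, Φ (X ω, Z ω)) :=
          hX.prodMk (hΦ.comp (hX.prodMk hZ))
        rw [Measure.map_apply hm hs, Measure.map_apply (hX.prodMk hZ) hs']
        rfl
      rw [h1, (indepFun_iff_map_prod_eq_prod_map_map hX.aemeasurable hZ.aemeasurable).1 hXZ,
        Measure.prod_apply hs']
      refine lintegral_congr fun x => ?_
      rw [hκ, Measure.map_apply hZ (measurable_prodMk_left hs'),
        Measure.map_apply (by fun_prop) (measurable_prodMk_left hs)]
      rfl)
  filter_upwards [ae_of_ae_map hX.aemeasurable h] with ω hω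
  rw [hω, hκ, integral_map (by fun_prop) f.continuous.measurable.aestronglyMeasurable]

end Conditional

/-! ### Averages and negligibility of triangular arrays. -/

section Cesaro

/-- Average of the first `n` terms of a sequence. -/
def cesaro (f : ℕ → ℝ) (n : ℕ) : ℝ := (n : ℝ)⁻¹ * ∑ k ∈ Finset.range n, f k

theorem cesaro_const {n : ℕ} (hn : n ≠ 0) (c : ℝ) : cesaro (fun _ => c) n = c := by
  have : (n : ℝ) ≠ 0 := by exact_mod_cast hn
  simp [cesaro]; field_simp

theorem cesaro_add (f g : ℕ → ℝ) (n : ℕ) :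
    cesaro (fun k => f k + g k) n = cesaro f n + cesaro g n := by
  simp [cesaro, Finset.sum_add_distrib, mul_add]

theorem cesaro_const_mul (c : ℝ) (f : ℕ → ℝ) (n : ℕ) :
    cesaro (fun k => c * f k) n = c * cesaro f n := by
  simp only [cesaro, ← Finset.mul_sum]; ring

theorem cesaro_sum {ι : Type*} (s : Finset ι) (f : ι → ℕ → ℝ) (n : ℕ) :
    cesaro (fun k => ∑ j ∈ s, f j k) n = ∑ j ∈ s, cesaro (f j) n := by
  simp only [cesaro, ← Finset.mul_sum]; rw [Finset.sum_comm]

/-- The terms of the `n`-th row of a triangular array are uniformly `o(√n)`. -/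
def RowNegligible (g : ℕ → ℕ → ℝ) : Prop :=
  ∀ δ > 0, ∀ᶠ n in atTop, ∀ k < n, |g n k| ≤ δ * √n

theorem RowNegligible.mul_left {g : ℕ → ℕ → ℝ} (hg : RowNegligible g) {c : ℕ → ℝ} {γ : ℝ}
    (hc : Tendsto c atTop (𝓝 γ)) : RowNegligible fun n k => c n * g n k := by
  intro δ hδ
  have h1 : ∀ᶠ n in atTop, |c n| < |γ| + 1 := hc.abs.eventually_lt_const (by linarith)
  filter_upwards [h1, hg (δ / (|γ| + 1)) (by positivity)] with n h1 h2 k hk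
  rw [abs_mul]
  calc |c n| * |g n k| ≤ (|γ| + 1) * (δ / (|γ| + 1) * √n) := by
        gcongr
        exact h2 k hk
    _ = δ * √n := by field_simp

theorem RowNegligible.sum {ι : Type*} (s : Finset ι) {g : ι → ℕ → ℕ → ℝ}
    (hg : ∀ j ∈ s, RowNegligible (g j)) : RowNegligible fun n k => ∑ j ∈ s, g j n k := by
  intro δ hδ
  -- The `+ 1` keeps the denominator positive when `s` is empty.
  have h : ∀ᶠ n in atTop, ∀ j ∈ s, ∀ k < n, |g j n k| ≤ δ / (s.card + 1) * √n :=
    (Finset.eventually_all s).2 fun j hj => hg j hj _ (by positivity)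
  filter_upwards [h] with n h k hk
  calc |∑ j ∈ s, g j n k| ≤ ∑ j ∈ s, |g j n k| := Finset.abs_sum_le_sum_abs _ _
    _ ≤ ∑ j ∈ s, δ / (s.card + 1) * √n := Finset.sum_le_sum fun j hj => h j hj k hk
    _ = (s.card / (s.card + 1)) * (δ * √n) := by rw [Finset.sum_const, nsmul_eq_mul]; ring
    _ ≤ 1 * (δ * √n) := by
        gcongr
        rw [div_le_one (by positivity)]; linarith
    _ = δ * √n := one_mul _

theorem rowNegligible_of_tendsto_cesaro {f : ℕ → ℝ} {L : ℝ}
    (hf : Tendsto (cesaro fun k => f k * f k) atTop (𝓝 L)) : RowNegligible fun _ k => f k := by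
  have hstep : Tendsto (fun k : ℕ => f k * f k / ((k : ℝ) + 1)) atTop (𝓝 0) := by
    have h1 : Tendsto (fun k : ℕ => (k : ℝ) / ((k : ℝ) + 1)) atTop (𝓝 1) :=
      tendsto_natCast_div_add_atTop 1
    -- With `A` the averages of the squares, `f k ^ 2 / (k + 1) = A (k + 1) - A k * k / (k + 1)`, a
    -- difference of two sequences with the same limit.
    have h2 := ((tendsto_add_atTop_iff_nat 1).2 hf).sub (hf.mul h1)
    rw [mul_one, sub_self] at h2
    refine h2.congr' ?_
    filter_upwards [eventually_gt_atTop 0] with k hk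
    have : (0 : ℝ) < k := by exact_mod_cast hk
    simp only [cesaro, Finset.sum_range_succ, Nat.cast_add, Nat.cast_one]
    field_simp
    ring
  intro δ hδ
  have h1 : ∀ᶠ k : ℕ in atTop, f k * f k / ((k : ℝ) + 1) < δ ^ 2 :=
    hstep.eventually_lt_const (by positivity)
  obtain ⟨K, hK⟩ := eventually_atTop.1 h1
  -- The finitely many terms before `K` are absorbed by letting `n` grow; the later ones satisfy `f
  -- k ^ 2 < δ ^ 2 * (k + 1) ≤ δ ^ 2 * n`.
  have h2 : ∀ᶠ n : ℕ in atTop, ∑ k ∈ Finset.range K, f k * f k ≤ δ ^ 2 * n :=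
    (tendsto_natCast_atTop_atTop.const_mul_atTop (by positivity)).eventually_ge_atTop _
  filter_upwards [h2] with n hn k hk
  refine abs_le_of_sq_le_sq ?_ (by positivity)
  rw [mul_pow, Real.sq_sqrt (Nat.cast_nonneg n), sq (f k)]
  rcases lt_or_ge k K with hkK | hkK
  · exact (Finset.single_le_sum (f := fun k => f k * f k) (fun j _ => mul_self_nonneg (f j))
      (Finset.mem_range.2 hkK)).trans hn
  · have h3 := hK k hkK
    rw [div_lt_iff₀ (by positivity)] at h3
    have h4 : (k : ℝ) + 1 ≤ n := by exact_mod_cast hk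
    nlinarith [sq_nonneg δ]

end Cesaro

/-! ### Centred products of coordinates along a typical sequence. -/

section Features

variable {Ω : Type*} [MeasurableSpace Ω] {d : ℕ}

/-- The monomials occurring in a product of two centred coordinates. -/
def feat (p : Fin d × Fin d) (j : Fin 4) (e : Fin d → ℝ) : ℝ :=
  ![e p.1 * e p.2, e p.1, e p.2, 1] j

/-- The weighted averages of products of two monomials along the sequence `x` converge to `γ` times
the corresponding moments of `e`. -/
def MomentLLN (P : Measure Ω) (e : Ω → Fin d → ℝ) (x : ℕ → Fin d → ℝ) (w : ℕ → ℝ) (γ : ℝ) : Prop :=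
  ∀ p j q l, Tendsto (cesaro fun k => w k * (feat p j (x k) * feat q l (x k))) atTop
    (𝓝 (γ * ∫ ω, feat p j (e ω) * feat q l (e ω) ∂P))

variable {P : Measure Ω} {e : Ω → Fin d → ℝ} {x : ℕ → Fin d → ℝ} {w : ℕ → ℝ} {γ : ℝ}

/-- The coefficients depend on `n` but not on `k`, so they leave the average and finitely many
scalar limits remain. This is how the random centring by sample means is handled. -/
theorem MomentLLN.tendsto_cesaro_lincomb (h : MomentLLN P e x w γ)
    (hint : ∀ p j q l, Integrable (fun ω => feat p j (e ω) * feat q l (e ω)) P)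
    (p q : Fin d × Fin d) (a b : ℕ → Fin 4 → ℝ) (α β : Fin 4 → ℝ)
    (ha : ∀ j, Tendsto (fun n => a n j) atTop (𝓝 (α j)))
    (hb : ∀ j, Tendsto (fun n => b n j) atTop (𝓝 (β j))) :
    Tendsto (fun n => cesaro (fun k => w k * ((∑ j, a n j * feat p j (x k)) *
      ∑ l, b n l * feat q l (x k))) n) atTop
      (𝓝 (γ * ∫ ω, (∑ j, α j * feat p j (e ω)) * ∑ l, β l * feat q l (e ω) ∂P)) := by
  have h1 : ∀ n, cesaro (fun k => w k * ((∑ j, a n j * feat p j (x k)) *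
      ∑ l, b n l * feat q l (x k))) n = ∑ j, ∑ l, a n j * b n l *
        cesaro (fun k => w k * (feat p j (x k) * feat q l (x k))) n := by
    intro n
    simp_rw [← cesaro_const_mul, ← cesaro_sum]
    congr 1
    ext k
    rw [Finset.sum_mul_sum, Finset.mul_sum]
    refine Finset.sum_congr rfl fun j _ => ?_
    rw [Finset.mul_sum]
    exact Finset.sum_congr rfl fun l _ => by ring
  have h2 : γ * ∫ ω, (∑ j, α j * feat p j (e ω)) * ∑ l, β l * feat q l (e ω) ∂P =
      ∑ j, ∑ l, α j * β l * (γ * ∫ ω, feat p j (e ω) * feat q l (e ω) ∂P) := by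
    have : ∀ ω, (∑ j, α j * feat p j (e ω)) * ∑ l, β l * feat q l (e ω) =
        ∑ j, ∑ l, α j * β l * (feat p j (e ω) * feat q l (e ω)) := by
      intro ω
      rw [Finset.sum_mul_sum]
      exact Finset.sum_congr rfl fun j _ => Finset.sum_congr rfl fun l _ => by ring
    simp_rw [this]
    rw [integral_finsetSum _ fun j _ => integrable_finsetSum _ fun l _ =>
      (hint p j q l).const_mul _, Finset.mul_sum]
    refine Finset.sum_congr rfl fun j _ => ?_
    rw [integral_finsetSum _ fun l _ => (hint p j q l).const_mul _, Finset.mul_sum]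
    refine Finset.sum_congr rfl fun l _ => ?_
    rw [integral_const_mul]
    ring
  simp_rw [h1, h2]
  exact tendsto_finsetSum _ fun j _ => tendsto_finsetSum _ fun l _ =>
    ((ha j).mul (hb l)).mul (h p j q l)

/-- The first `n` terms of a sequence, as a sample. -/
abbrev initial {α : Type*} (x : ℕ → α) (n : ℕ) : Fin n → α := fun k => x k

/-- Product of two coordinates of the centred observation `x k - x̄ₙ`. -/
def residProd (x : ℕ → Fin d → ℝ) (n k : ℕ) (p : Fin d × Fin d) : ℝ :=
  (x k p.1 - sampleMean (initial x n) p.1) * (x k p.2 - sampleMean (initial x n) p.2)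

/-- The product of two coordinates of `x k - x̄ₙ`, centred at its sample mean. -/
def centredProd (x : ℕ → Fin d → ℝ) (n k : ℕ) (p : Fin d × Fin d) : ℝ :=
  residProd x n k p - cesaro (fun k => residProd x n k p) n

theorem sampleMean_initial {ι : Type*} (y : ℕ → ι → ℝ) (n : ℕ) (q : ι) :
    sampleMean (initial y n) q = cesaro (fun k => y k q) n := by
  simp [sampleMean, cesaro, Finset.sum_range]

theorem residProd_eq (x : ℕ → Fin d → ℝ) (n k : ℕ) (p : Fin d × Fin d) :
    residProd x n k p = ∑ j, ![1, -sampleMean (initial x n) p.2, -sampleMean (initial x n) p.1,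
      sampleMean (initial x n) p.1 * sampleMean (initial x n) p.2] j * feat p j (x k) := by
  simp [residProd, feat, Fin.sum_univ_four]
  ring

/-- The coefficients of `centredProd` in terms of the monomials `feat`. -/
def centredCoeff (x : ℕ → Fin d → ℝ) (p : Fin d × Fin d) (n : ℕ) : Fin 4 → ℝ :=
  ![1, -sampleMean (initial x n) p.2, -sampleMean (initial x n) p.1,
      sampleMean (initial x n) p.1 * sampleMean (initial x n) p.2 -
        cesaro (fun k => residProd x n k p) n]

theorem centredProd_eq (x : ℕ → Fin d → ℝ) (n k : ℕ) (p : Fin d × Fin d) :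
    centredProd x n k p = ∑ j, centredCoeff x p n j * feat p j (x k) := by
  rw [centredProd, residProd_eq]
  simp [centredCoeff, feat, Fin.sum_univ_four]
  ring

/-- `e` is centred with integrable fourth order moments, and `x` obeys the law of large numbers for
these moments. -/
structure IsTypical (P : Measure Ω) (e : Ω → Fin d → ℝ) (x : ℕ → Fin d → ℝ) : Prop where
  lln : MomentLLN P e x (fun _ => 1) 1
  integrable : ∀ p j q l, Integrable (fun ω => feat p j (e ω) * feat q l (e ω)) P
  mean : ∀ a, ∫ ω, e ω a ∂P = 0

theorem IsTypical.tendsto_sampleMean_initial (h : IsTypical P e x) (a : Fin d) :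
    Tendsto (fun n => sampleMean (initial x n) a) atTop (𝓝 0) := by
  -- Feature `1` is the coordinate itself and feature `3` is the constant one.
  have := h.lln (a, a) 1 (a, a) 3
  simp only [feat, Matrix.cons_val, mul_one, one_mul, h.mean] at this
  exact this.congr fun n => (sampleMean_initial x n a).symm

theorem IsTypical.tendsto_cesaro_residProd (h : IsTypical P e x) (p : Fin d × Fin d) :
    Tendsto (fun n => cesaro (fun k => residProd x n k p) n) atTop
      (𝓝 (∫ ω, e ω p.1 * e ω p.2 ∂P)) := by
  have hm := h.tendsto_sampleMean_initial
  -- The second factor `![0, 0, 0, 1]` selects the constant feature, which turns the law for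
  -- products into one for a single factor.
  have := h.lln.tendsto_cesaro_lincomb h.integrable p p
    (fun n => ![1, -sampleMean (initial x n) p.2, -sampleMean (initial x n) p.1,
      sampleMean (initial x n) p.1 * sampleMean (initial x n) p.2]) (fun _ => ![0, 0, 0, 1])
    ![1, 0, 0, 0] ![0, 0, 0, 1] (by
      intro j
      fin_cases j
      · exact tendsto_const_nhds
      · simpa using (hm p.2).neg
      · simpa using (hm p.1).neg
      · simpa using (hm p.1).mul (hm p.2)) (fun j => tendsto_const_nhds)
  simp_rw [← residProd_eq] at this
  simpa [Fin.sum_univ_four, feat] using this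

theorem IsTypical.tendsto_centredCoeff (h : IsTypical P e x) (p : Fin d × Fin d) (j : Fin 4) :
    Tendsto (fun n => centredCoeff x p n j) atTop
      (𝓝 (![1, 0, 0, -∫ ω, e ω p.1 * e ω p.2 ∂P] j)) := by
  have hm := h.tendsto_sampleMean_initial
  fin_cases j
  · exact tendsto_const_nhds
  · simpa [centredCoeff] using (hm p.2).neg
  · simpa [centredCoeff] using (hm p.1).neg
  · simpa [centredCoeff] using
      ((hm p.1).mul (hm p.2)).sub (h.tendsto_cesaro_residProd p)

theorem IsTypical.tendsto_cesaro_centredProd_mul (h : IsTypical P e x) (hw : MomentLLN P e x w γ)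
    (p q : Fin d × Fin d) :
    Tendsto (fun n => cesaro (fun k => w k * (centredProd x n k p * centredProd x n k q)) n) atTop
      (𝓝 (γ * ∫ ω, (e ω p.1 * e ω p.2 - ∫ ω, e ω p.1 * e ω p.2 ∂P) *
        (e ω q.1 * e ω q.2 - ∫ ω, e ω q.1 * e ω q.2 ∂P) ∂P)) := by
  have := hw.tendsto_cesaro_lincomb h.integrable p q (centredCoeff x p) (centredCoeff x q) _ _
    (h.tendsto_centredCoeff p) (h.tendsto_centredCoeff q)
  simp_rw [← centredProd_eq] at this
  simpa [Fin.sum_univ_four, feat, sub_eq_add_neg] using this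

theorem IsTypical.tendsto_cesaro_centredProd [IsProbabilityMeasure P] (h : IsTypical P e x)
    (hw : MomentLLN P e x w γ)
    (p : Fin d × Fin d) :
    Tendsto (fun n => cesaro (fun k => w k * centredProd x n k p) n) atTop (𝓝 0) := by
  have := hw.tendsto_cesaro_lincomb h.integrable p p (centredCoeff x p) (fun _ => ![0, 0, 0, 1]) _
    ![0, 0, 0, 1] (h.tendsto_centredCoeff p) (fun j => tendsto_const_nhds)
  simp_rw [← centredProd_eq] at this
  have hi : Integrable (fun ω => e ω p.1 * e ω p.2) P := by
    simpa [feat] using h.integrable p 0 p 3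
  have h0 : ∫ ω, (e ω p.1 * e ω p.2 + -∫ ω, e ω p.1 * e ω p.2 ∂P) ∂P = 0 := by
    rw [integral_add hi (integrable_const _)]; simp
  simpa [Fin.sum_univ_four, feat, h0] using this

theorem IsTypical.rowNegligible_centredProd (h : IsTypical P e x) (p : Fin d × Fin d) :
    RowNegligible fun n k => centredProd x n k p := by
  simp_rw [centredProd_eq]
  refine RowNegligible.sum _ fun j _ => ?_
  have hj := h.lln p j p j
  simp only [one_mul] at hj
  exact (rowNegligible_of_tendsto_cesaro hj).mul_left (h.tendsto_centredCoeff p j)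

end Features

/-! ### Limits for the coefficient vectors of the weights. -/

section WildVectors

variable {Ω : Type*} [MeasurableSpace Ω] {d : ℕ} {P : Measure Ω} {e : Ω → Fin d → ℝ}
  {x : ℕ → Fin d → ℝ} {w : ℕ → ℝ} {γ : ℝ}

theorem matM_apply (v : VechIdx d → ℝ) (r : UpIdx d → ℝ) (q : UpIdx d) (p : VechIdx d) :
    matM v r q p = (elimUp d q p - (1 / 2 : ℝ) * (r q * matM1 d q p)) *
      (v (diagPos p.1.1) * v (diagPos p.1.2)) ^ (-(1 / 2) : ℝ) := by
  simp [matM, Matrix.mul_diagonal, Matrix.diagonal_mul, vech, Matrix.vecMulVec_apply]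

/-- Positive limiting variances keep the power `-1/2` and the correlation denominators away from
their singularity at zero; degenerate empirical variances at finite `n` play no role. -/
theorem tendsto_matMOfCov {V : ℕ → Matrix (Fin d) (Fin d) ℝ} {V₀ : Matrix (Fin d) (Fin d) ℝ}
    (hV : ∀ j k, Tendsto (fun n => V n j k) atTop (𝓝 (V₀ j k))) (hpos : ∀ j, 0 < V₀ j j)
    (q : UpIdx d) (p : VechIdx d) :
    Tendsto (fun n => matMOfCov (V n) q p) atTop (𝓝 (matMOfCov V₀ q p)) := by
  simp only [matMOfCov, matM_apply, vech, vechUp, corrMatrix, Matrix.of_apply, diagPos]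
  have hne : ∀ j k, V₀ j j * V₀ k k ≠ 0 := fun j k => (mul_pos (hpos j) (hpos k)).ne'
  refine Tendsto.mul (tendsto_const_nhds.sub (tendsto_const_nhds.mul (Tendsto.mul ?_
    tendsto_const_nhds))) (((hV _ _).mul (hV _ _)).rpow_const (Or.inl (hne _ _)))
  exact (hV _ _).div ((Real.continuous_sqrt.tendsto _).comp ((hV _ _).mul (hV _ _)))
    (Real.sqrt_ne_zero'.2 (mul_pos (hpos _) (hpos _)))

theorem sampleCov_initial {ι : Type*} (y : ℕ → ι → ℝ) {n : ℕ} (hn : n ≠ 0) (a b : ι) :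
    sampleCov (initial y n) a b = n / ((n : ℝ) - 1) *
      cesaro (fun k => (y k a - sampleMean (initial y n) a) *
        (y k b - sampleMean (initial y n) b)) n := by
  have hn' : (n : ℝ) ≠ 0 := by exact_mod_cast hn
  simp only [sampleCov, Matrix.smul_apply, Matrix.sum_apply, Matrix.vecMulVec_apply,
    Pi.sub_apply, smul_eq_mul, cesaro, Finset.sum_range]
  field_simp

theorem sampleCov_initial_eq_sub {ι : Type*} (y : ℕ → ι → ℝ) {n : ℕ} (hn : n ≠ 0) (a b : ι) :
    sampleCov (initial y n) a b = n / ((n : ℝ) - 1) *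
      (cesaro (fun k => y k a * y k b) n -
        cesaro (fun k => y k a) n * cesaro (fun k => y k b) n) := by
  rw [sampleCov_initial y hn]
  congr 1
  simp_rw [sampleMean_initial]
  generalize ha : cesaro (fun k => y k a) n = α
  generalize hb : cesaro (fun k => y k b) n = β
  have : ∀ k, (y k a - α) * (y k b - β) = y k a * y k b + ((-β) * y k a + ((-α) * y k b + α * β)) :=
    fun k => by ring
  simp_rw [this]
  rw [cesaro_add, cesaro_add, cesaro_add, cesaro_const_mul, cesaro_const_mul, cesaro_const hn,
    ha, hb]
  ring

theorem tendsto_natCast_div_sub_one :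
    Tendsto (fun n : ℕ => (n : ℝ) / ((n : ℝ) - 1)) atTop (𝓝 1) := by
  simpa [sub_eq_add_neg] using tendsto_natCast_div_add_atTop (-1 : ℝ)

theorem IsTypical.covMatrix_apply [IsProbabilityMeasure P] (h : IsTypical P e x)
    (a b : Fin d) : covMatrix P e a b = ∫ ω, e ω a * e ω b ∂P := by
  simp [covMatrix, covariance, h.mean]

theorem IsTypical.tendsto_sampleCov [IsProbabilityMeasure P] (h : IsTypical P e x)
    (a b : Fin d) :
    Tendsto (fun n => sampleCov (initial x n) a b) atTop (𝓝 (covMatrix P e a b)) := by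
  have := tendsto_natCast_div_sub_one.mul (h.tendsto_cesaro_residProd (a, b))
  rw [one_mul] at this
  rw [h.covMatrix_apply]
  refine this.congr' ?_
  filter_upwards [eventually_ne_atTop 0] with n hn
  rw [sampleCov_initial x hn]
  rfl

/-- The factor of the weight in the wild bootstrap sample. -/
def wildVec (x : ℕ → Fin d → ℝ) (n k : ℕ) (q : UpIdx d) : ℝ :=
  ∑ p : VechIdx d, matMOfCov (sampleCov (initial x n)) q p * centredProd x n k p.1

theorem wildSample_initial (x : ℕ → Fin d → ℝ) (w : ℕ → ℝ) (n : ℕ) (k : Fin n) (q : UpIdx d) :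
    wildSample (initial x n) (initial w n) k q = w k * wildVec x n k q := by
  have : ∀ p : VechIdx d, sampleMean (vechResid (initial x n)) p =
      cesaro (fun k => residProd x n k p.1) n := fun p =>
    sampleMean_initial (fun k (p : VechIdx d) => residProd x n k p.1) n p
  simp only [wildSample, Pi.smul_apply, smul_eq_mul, Matrix.mulVec, dotProduct, wildVec,
    Pi.sub_apply, this]
  rfl

theorem IsTypical.tendsto_matMOfCov [IsProbabilityMeasure P] (h : IsTypical P e x)
    (hpos : ∀ j, 0 < covMatrix P e j j) (q : UpIdx d) (p : VechIdx d) :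
    Tendsto (fun n => matMOfCov (sampleCov (initial x n)) q p) atTop
      (𝓝 (matMOfCov (covMatrix P e) q p)) :=
  WildBootstrap.tendsto_matMOfCov h.tendsto_sampleCov hpos q p

theorem IsTypical.tendsto_cesaro_wildVec_mul [IsProbabilityMeasure P] (h : IsTypical P e x)
    (hpos : ∀ j, 0 < covMatrix P e j j) (hw : MomentLLN P e x w γ) (q r : UpIdx d) :
    Tendsto (fun n => cesaro (fun k => w k * (wildVec x n k q * wildVec x n k r)) n) atTop
      (𝓝 (γ * upsilon P e q r)) := by
  have h1 : ∀ n, cesaro (fun k => w k * (wildVec x n k q * wildVec x n k r)) n =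
      ∑ s : VechIdx d, ∑ p : VechIdx d, matMOfCov (sampleCov (initial x n)) q p *
        matMOfCov (sampleCov (initial x n)) r s *
        cesaro (fun k => w k * (centredProd x n k p.1 * centredProd x n k s.1)) n := by
    intro n
    simp_rw [← cesaro_const_mul, ← cesaro_sum]
    congr 1
    ext k
    rw [wildVec, wildVec, Finset.sum_mul_sum, Finset.mul_sum, Finset.sum_comm]
    refine Finset.sum_congr rfl fun j _ => ?_
    rw [Finset.mul_sum]
    exact Finset.sum_congr rfl fun l _ => by ring
  have h2 : γ * upsilon P e q r = ∑ s : VechIdx d, ∑ p : VechIdx d,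
      matMOfCov (covMatrix P e) q p * matMOfCov (covMatrix P e) r s *
        (γ * covMatrix P (fun ω => vech (Matrix.vecMulVec (e ω) (e ω))) p s) := by
    simp only [upsilon, Matrix.mul_apply, Matrix.transpose_apply, Finset.sum_mul, Finset.mul_sum]
    exact Finset.sum_congr rfl fun s _ => Finset.sum_congr rfl fun p _ => by ring
  simp_rw [h1, h2]
  refine tendsto_finsetSum _ fun s _ => tendsto_finsetSum _ fun p _ =>
    ((h.tendsto_matMOfCov hpos q p).mul (h.tendsto_matMOfCov hpos r s)).mul ?_
  -- The covariance of the vectorized products unfolds to the limit of the averages of centred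
  -- products.
  exact h.tendsto_cesaro_centredProd_mul hw p.1 s.1

theorem IsTypical.tendsto_cesaro_wildVec [IsProbabilityMeasure P] (h : IsTypical P e x)
    (hpos : ∀ j, 0 < covMatrix P e j j) (hw : MomentLLN P e x w γ) (q : UpIdx d) :
    Tendsto (fun n => cesaro (fun k => w k * wildVec x n k q) n) atTop (𝓝 0) := by
  have h1 : ∀ n, cesaro (fun k => w k * wildVec x n k q) n =
      ∑ p : VechIdx d, matMOfCov (sampleCov (initial x n)) q p *
        cesaro (fun k => w k * centredProd x n k p.1) n := by
    intro n
    simp_rw [← cesaro_const_mul, ← cesaro_sum]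
    congr 1
    ext k
    rw [wildVec, Finset.mul_sum]
    exact Finset.sum_congr rfl fun l _ => by ring
  simp_rw [h1]
  simpa using tendsto_finsetSum Finset.univ fun (p : VechIdx d) _ =>
    (h.tendsto_matMOfCov hpos q p).mul (h.tendsto_cesaro_centredProd hw p.1)

theorem IsTypical.rowNegligible_wildVec [IsProbabilityMeasure P] (h : IsTypical P e x)
    (hpos : ∀ j, 0 < covMatrix P e j j) (q : UpIdx d) :
    RowNegligible fun n k => wildVec x n k q :=
  RowNegligible.sum _ fun p _ =>
    (h.rowNegligible_centredProd p.1).mul_left (h.tendsto_matMOfCov hpos q p)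

/-- Convergence of the empirical covariance matrix of the wild bootstrap sample. -/
theorem IsTypical.tendsto_sampleCov_wildSample [IsProbabilityMeasure P] (h : IsTypical P e x)
    (hpos : ∀ j, 0 < covMatrix P e j j) {γ' : ℝ} (hw : MomentLLN P e x w γ')
    (hw2 : MomentLLN P e x (fun k => w k ^ 2) γ) (q r : UpIdx d) :
    Tendsto (fun n => sampleCov (wildSample (initial x n) (initial w n)) q r) atTop
      (𝓝 (γ * upsilon P e q r)) := by
  -- The averages weighted by `w` vanish whatever `γ'` is, because the centred products have mean
  -- zero in the limit; only the second moments weighted by `w ^ 2` survive.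
  have := tendsto_natCast_div_sub_one.mul ((h.tendsto_cesaro_wildVec_mul hpos hw2 q r).sub
    ((h.tendsto_cesaro_wildVec hpos hw q).mul (h.tendsto_cesaro_wildVec hpos hw r)))
  rw [one_mul, mul_zero, sub_zero] at this
  refine this.congr' ?_
  filter_upwards [eventually_ne_atTop 0] with n hn
  have h1 : wildSample (initial x n) (initial w n) =
      initial (fun k q => w k * wildVec x n k q) n := by
    ext k q
    exact wildSample_initial x w n k q
  rw [h1, sampleCov_initial_eq_sub _ hn]
  congr 3
  ext k
  ring

theorem IsTypical.tendsto_cesaro_wildVec_dotProduct_sq [IsProbabilityMeasure P]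
    (h : IsTypical P e x) (hpos : ∀ j, 0 < covMatrix P e j j) (t : UpIdx d → ℝ) :
    Tendsto (fun n => cesaro (fun k => (wildVec x n k ⬝ᵥ t) ^ 2) n) atTop
      (𝓝 (t ⬝ᵥ upsilon P e *ᵥ t)) := by
  have h1 : ∀ n, cesaro (fun k => (wildVec x n k ⬝ᵥ t) ^ 2) n = ∑ q, ∑ r, t q * t r *
      cesaro (fun k => 1 * (wildVec x n k q * wildVec x n k r)) n := by
    intro n
    simp_rw [← cesaro_const_mul, ← cesaro_sum]
    congr 1
    ext k
    rw [sq, dotProduct, Finset.sum_mul_sum]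
    exact Finset.sum_congr rfl fun q _ => Finset.sum_congr rfl fun l _ => by ring
  have h2 : t ⬝ᵥ upsilon P e *ᵥ t = ∑ q, ∑ r, t q * t r * (1 * upsilon P e q r) := by
    simp only [dotProduct, Matrix.mulVec, Finset.mul_sum]
    exact Finset.sum_congr rfl fun q _ => Finset.sum_congr rfl fun l _ => by ring
  simp_rw [h1, h2]
  exact tendsto_finsetSum _ fun q _ => tendsto_finsetSum _ fun r _ =>
    (h.tendsto_cesaro_wildVec_mul hpos h.lln q r).const_mul _

theorem IsTypical.rowNegligible_wildVec_dotProduct [IsProbabilityMeasure P]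
    (h : IsTypical P e x) (hpos : ∀ j, 0 < covMatrix P e j j) (t : UpIdx d → ℝ) :
    RowNegligible fun n k => wildVec x n k ⬝ᵥ t := by
  simp_rw [dotProduct, mul_comm _ (t _)]
  exact RowNegligible.sum _ fun q _ =>
    (h.rowNegligible_wildVec hpos q).mul_left tendsto_const_nhds

end WildVectors

/-! ### Invariance under translation of the data. -/

section ShiftInvariance

variable {d n : ℕ}

theorem sub_sampleMean_add_const (c : Fin d → ℝ) (x : Fin n → Fin d → ℝ) (k : Fin n) :
    (c + x k) - sampleMean (fun k => c + x k) = x k - sampleMean x := by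
  have hn : (n : ℝ) ≠ 0 := by exact_mod_cast (Fin.pos k).ne'
  ext a
  simp only [sampleMean, Finset.sum_add_distrib, Finset.sum_const, Finset.card_univ,
    Fintype.card_fin, smul_add, Pi.sub_apply, Pi.add_apply, Pi.smul_apply, smul_eq_mul,
    nsmul_eq_mul, Pi.mul_apply, Pi.natCast_apply]
  field_simp
  ring

/-- This removes the means `μ i`, so that the data may be replaced by the centred residuals. -/
theorem wildSample_add_const (c : Fin d → ℝ) (x : Fin n → Fin d → ℝ) (w : Fin n → ℝ) :
    wildSample (fun k => c + x k) w = wildSample x w := by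
  have h1 : vechResid (fun k => c + x k) = vechResid x := by
    ext k
    simp only [vechResid, sub_sampleMean_add_const]
  have h2 : sampleCov (fun k => c + x k) = sampleCov x := by
    simp only [sampleCov, sub_sampleMean_add_const]
  ext k
  simp only [wildSample, h1, h2]

end ShiftInvariance

/-! ### Regrouping independent pairs. -/

section Independence

variable {Ω α β α' β' : Type*} [MeasurableSpace Ω] [mα : MeasurableSpace α]
  [mβ : MeasurableSpace β] [mα' : MeasurableSpace α'] [mβ' : MeasurableSpace β'] {P : Measure Ω}

theorem comap_prod_eq_generateFrom {Ω : Type*} (f : Ω → α × β) :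
    MeasurableSpace.comap f inferInstance = MeasurableSpace.generateFrom
      (Set.preimage f '' Set.image2 (· ×ˢ ·) {s | MeasurableSet s} {t | MeasurableSet t}) := by
  rw [← MeasurableSpace.comap_generateFrom, generateFrom_prod]

theorem isPiSystem_preimage_prod {Ω : Type*} (f : Ω → α × β) : IsPiSystem
    (Set.preimage f '' Set.image2 (· ×ˢ ·) {s | MeasurableSet s} {t | MeasurableSet t}) :=
  (isPiSystem_prod (α := α) (β := β)).comap f

/-- Rectangles form a generating π-system, and on them both sides split into the same four factors.
It serves to make the pairs `(ε k, W k)` pairwise independent. -/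
theorem indepFun_prodMk_of_indepFun_prodMk [IsProbabilityMeasure P] {A : Ω → α} {B : Ω → β}
    {A' : Ω → α'} {B' : Ω → β'} (hA : Measurable A) (hB : Measurable B) (hA' : Measurable A')
    (hB' : Measurable B') (hAB : IndepFun (fun ω => (A ω, A' ω)) (fun ω => (B ω, B' ω)) P)
    (hAA : IndepFun A A' P) (hBB : IndepFun B B' P) :
    IndepFun (fun ω => (A ω, B ω)) (fun ω => (A' ω, B' ω)) P := by
  refine IndepSets.indep (hA.prodMk hB).comap_le (hA'.prodMk hB').comap_le (isPiSystem_preimage_prod _)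
    (isPiSystem_preimage_prod _) (comap_prod_eq_generateFrom _) (comap_prod_eq_generateFrom _) ?_
  rw [IndepSets_iff]
  rintro _ _ ⟨_, ⟨s, hs, t, ht, rfl⟩, rfl⟩ ⟨_, ⟨s', hs', t', ht', rfl⟩, rfl⟩
  have h1 := hAB.measure_inter_preimage_eq_mul _ _ (hs.prod hs') (ht.prod ht')
  have h2 := hAA.measure_inter_preimage_eq_mul _ _ hs hs'
  have h3 := hBB.measure_inter_preimage_eq_mul _ _ ht ht'
  have h4 := (hAB.comp measurable_fst measurable_fst).measure_inter_preimage_eq_mul _ _ hs ht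
  have h5 := (hAB.comp measurable_snd measurable_snd).measure_inter_preimage_eq_mul _ _ hs' ht'
  have e1 : (fun ω => (A ω, B ω)) ⁻¹' s ×ˢ t ∩ (fun ω => (A' ω, B' ω)) ⁻¹' s' ×ˢ t' =
      (fun ω => (A ω, A' ω)) ⁻¹' s ×ˢ s' ∩ (fun ω => (B ω, B' ω)) ⁻¹' t ×ˢ t' := by
    ext ω; simp; tauto
  have e2 : (fun ω => (A ω, A' ω)) ⁻¹' s ×ˢ s' = A ⁻¹' s ∩ A' ⁻¹' s' := rfl
  have e3 : (fun ω => (B ω, B' ω)) ⁻¹' t ×ˢ t' = B ⁻¹' t ∩ B' ⁻¹' t' := rfl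
  have e4 : P ((fun ω => (A ω, B ω)) ⁻¹' s ×ˢ t) = P (A ⁻¹' s) * P (B ⁻¹' t) := h4
  have e5 : P ((fun ω => (A' ω, B' ω)) ⁻¹' s' ×ˢ t') = P (A' ⁻¹' s') * P (B' ⁻¹' t') := h5
  rw [e1, h1, e2, e3, h2, h3, e4, e5]
  ring

end Independence

/-! ### Strong law: almost every sample is typical. -/

section LawOfLargeNumbers

variable {Ω : Type*} [MeasurableSpace Ω] {P : Measure Ω} [IsProbabilityMeasure P] {d : ℕ}

theorem measurable_feat (p : Fin d × Fin d) (j : Fin 4) : Measurable (feat p j) := by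
  unfold feat
  fin_cases j <;> simp <;> fun_prop

theorem abs_feat_le (p : Fin d × Fin d) (j : Fin 4) (e : Fin d → ℝ) :
    |feat p j e| ≤ 1 + ‖(WithLp.toLp 2 e : EuclideanSpace ℝ (Fin d))‖ ^ 2 := by
  set r := ‖(WithLp.toLp 2 e : EuclideanSpace ℝ (Fin d))‖
  have h : ∀ a, |e a| ≤ r := fun a =>
    PiLp.norm_apply_le (WithLp.toLp 2 e : EuclideanSpace ℝ (Fin d)) a
  have hr : 0 ≤ r := norm_nonneg _
  have h1 : r ≤ 1 + r ^ 2 := by nlinarith [sq_nonneg (r - 1)]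
  fin_cases j
  · simp only [feat, Fin.zero_eta, Matrix.cons_val_zero, abs_mul]
    nlinarith [mul_le_mul (h p.1) (h p.2) (abs_nonneg _) hr]
  · exact (h p.1).trans h1
  · exact (h p.2).trans h1
  · simp only [feat, Fin.reduceFinMk, Matrix.cons_val, abs_one]
    nlinarith [sq_nonneg r]

/-- Each feature is at most `1 + r ^ 2` with `r` the Euclidean norm, and `(1 + r ^ 2) ^ 2 ≤ 2 + 2 *
r ^ 4`. -/
theorem integrable_feat_mul_feat {e : Ω → Fin d → ℝ} (he : Measurable e)
    (h4 : Integrable (fun ω => ‖(WithLp.toLp 2 (e ω) : EuclideanSpace ℝ (Fin d))‖ ^ 4) P)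
    (p : Fin d × Fin d) (j : Fin 4) (q : Fin d × Fin d) (l : Fin 4) :
    Integrable (fun ω => feat p j (e ω) * feat q l (e ω)) P := by
  refine Integrable.mono' ((integrable_const 2).add (h4.const_mul 2))
    (((measurable_feat p j).comp he).mul ((measurable_feat q l).comp he)).aestronglyMeasurable
    (Eventually.of_forall fun ω => ?_)
  rw [Real.norm_eq_abs, abs_mul]
  refine (mul_le_mul (abs_feat_le p j _) (abs_feat_le q l _) (abs_nonneg _)
    (by positivity)).trans ?_
  simp only [Pi.add_apply]
  nlinarith [sq_nonneg (1 - ‖(WithLp.toLp 2 (e ω) : EuclideanSpace ℝ (Fin d))‖ ^ 2)]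

variable {ε : ℕ → Ω → Fin d → ℝ} {W : ℕ → Ω → ℝ}

/-- Weighted law of large numbers for the moments up to order four of an i.i.d. sequence with
independent i.i.d. weights. -/
theorem ae_momentLLN (hε : ∀ k, Measurable (ε k)) (hW : ∀ k, Measurable (W k))
    (hεi : iIndepFun ε P) (hWi : iIndepFun W P)
    (hεd : ∀ k, IdentDistrib (ε k) (ε 0) P P) (hWd : ∀ k, IdentDistrib (W k) (W 0) P P)
    (hεW : IndepFun (fun ω k => ε k ω) (fun ω k => W k ω) P)
    (h4 : Integrable (fun ω => ‖(WithLp.toLp 2 (ε 0 ω) : EuclideanSpace ℝ (Fin d))‖ ^ 4) P)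
    (g : ℝ → ℝ) (hg : Measurable g) (hgi : Integrable (fun ω => g (W 0 ω)) P) :
    ∀ᵐ ω ∂P, MomentLLN P (ε 0) (fun k => ε k ω) (fun k => g (W k ω)) (∫ ω, g (W 0 ω) ∂P) := by
  simp only [MomentLLN, ae_all_iff]
  intro p j q l
  have hεWk : ∀ k, IndepFun (ε k) (W k) P := fun k =>
    hεW.comp (measurable_pi_apply k) (measurable_pi_apply k)
  let H : (Fin d → ℝ) × ℝ → ℝ := fun z => g z.2 * (feat p j z.1 * feat q l z.1)
  have hH : Measurable H := (hg.comp measurable_snd).mul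
    (((measurable_feat p j).comp measurable_fst).mul ((measurable_feat q l).comp measurable_fst))
  have hF : Measurable fun e : Fin d → ℝ => feat p j e * feat q l e :=
    (measurable_feat p j).mul (measurable_feat q l)
  have hind : IndepFun (fun ω => g (W 0 ω)) (fun ω => feat p j (ε 0 ω) * feat q l (ε 0 ω)) P :=
    (hεWk 0).symm.comp hg hF
  have hfi := integrable_feat_mul_feat (hε 0) h4 p j q l
  have hident : ∀ k, IdentDistrib (fun ω => (ε k ω, W k ω)) (fun ω => (ε 0 ω, W 0 ω)) P P := by
    intro k
    refine ⟨((hε k).prodMk (hW k)).aemeasurable, ((hε 0).prodMk (hW 0)).aemeasurable, ?_⟩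
    rw [(indepFun_iff_map_prod_eq_prod_map_map (hε k).aemeasurable (hW k).aemeasurable).1 (hεWk k),
      (indepFun_iff_map_prod_eq_prod_map_map (hε 0).aemeasurable (hW 0).aemeasurable).1 (hεWk 0),
      (hεd k).map_eq, (hWd k).map_eq]
  -- This strong law asks only for pairwise independence, so regrouping two indices is enough.
  have key := strong_law_ae_real (μ := P) (fun k ω => H (ε k ω, W k ω))
    (hind.integrable_mul hgi hfi) (by
      intro k k' hkk
      refine IndepFun.comp (indepFun_prodMk_of_indepFun_prodMk (hε k) (hW k) (hε k') (hW k') ?_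
        (hεi.indepFun hkk) (hWi.indepFun hkk)) hH hH
      exact hεW.comp ((measurable_pi_apply k).prodMk (measurable_pi_apply k'))
        ((measurable_pi_apply k).prodMk (measurable_pi_apply k')))
    (fun k => (hident k).comp hH)
  filter_upwards [key] with ω hω
  have hE : ∫ ω, H (ε 0 ω, W 0 ω) ∂P =
      (∫ ω, g (W 0 ω) ∂P) * ∫ ω, feat p j (ε 0 ω) * feat q l (ε 0 ω) ∂P :=
    hind.integral_fun_mul_eq_mul_integral hgi.aestronglyMeasurable hfi.aestronglyMeasurable
  rw [hE] at hω
  refine hω.congr fun n => ?_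
  rw [cesaro, div_eq_inv_mul]

theorem ae_isTypical (hε : ∀ k, Measurable (ε k)) (hW : ∀ k, Measurable (W k))
    (hεi : iIndepFun ε P) (hWi : iIndepFun W P)
    (hεd : ∀ k, IdentDistrib (ε k) (ε 0) P P) (hWd : ∀ k, IdentDistrib (W k) (W 0) P P)
    (hεW : IndepFun (fun ω k => ε k ω) (fun ω k => W k ω) P)
    (h4 : Integrable (fun ω => ‖(WithLp.toLp 2 (ε 0 ω) : EuclideanSpace ℝ (Fin d))‖ ^ 4) P)
    (h0 : ∫ ω, ε 0 ω ∂P = 0) :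
    ∀ᵐ ω ∂P, IsTypical P (ε 0) (fun k => ε k ω) := by
  have hint := integrable_feat_mul_feat (hε 0) h4
  have h1 := ae_momentLLN hε hW hεi hWi hεd hWd hεW h4 (fun _ => 1) measurable_const
    (integrable_const _)
  simp only [integral_const, probReal_univ, smul_eq_mul, mul_one] at h1
  filter_upwards [h1] with ω hω
  refine ⟨hω, hint, fun a => ?_⟩
  have hi : ∀ a, Integrable (fun ω => ε 0 ω a) P := fun a => by
    simpa [feat] using hint (a, a) 1 (a, a) 3
  rw [← eval_integral hi, h0, Pi.zero_apply]

end LawOfLargeNumbers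

/-! ### Uniform expansion of the weight characteristic functions. -/

section Gaussian

variable {Ω : Type*} [MeasurableSpace Ω] {P : Measure Ω} [IsProbabilityMeasure P]

theorem charFun_bound_uniform {a : ℕ} {W : Fin a → ℕ → Ω → ℝ} (hW : ∀ i k, Measurable (W i k))
    (hd : ∀ i k, IdentDistrib (W i k) (W i 0) P P) (h0 : ∀ i, ∫ ω, W i 0 ω ∂P = 0)
    (h1 : ∀ i, ∫ ω, W i 0 ω ^ 2 ∂P = 1) {η : ℝ} (hη : 0 < η) :
    ∃ δ > 0, ∀ i k, ∀ t : ℝ, |t| ≤ δ →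
      ‖charFun (P.map (W i k)) t - Complex.exp (-(t : ℂ) ^ 2 / 2)‖ ≤ η * t ^ 2 := by
  have h : ∀ᶠ t in 𝓝 (0 : ℝ), ∀ i,
      ‖charFun (P.map (W i 0)) t - Complex.exp (-(t : ℂ) ^ 2 / 2)‖ ≤ η * ‖t ^ 2‖ :=
    eventually_all.2 fun i =>
      (isLittleO_charFun_sub_exp (hW i 0).aemeasurable (h0 i) (h1 i)).def hη
  obtain ⟨δ, hδ, hδ'⟩ := Metric.eventually_nhds_iff.1 h
  -- Only finitely many laws occur, one per group, so one `δ` serves all; halving it allows a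
  -- non-strict bound on `t`.
  refine ⟨δ / 2, by positivity, fun i k t ht => ?_⟩
  have := hδ' (y := t) (by rw [Real.dist_eq, sub_zero]; linarith) i
  rwa [Real.norm_eq_abs, abs_sq, ← (hd i k).map_eq] at this

end Gaussian

/-! ### Measurability of the bootstrap sample. -/

section Measurability

variable {Ω : Type*} [MeasurableSpace Ω] {d n : ℕ}

theorem measurable_sampleMean {ι : Type*} {y : Ω → Fin n → ι → ℝ}
    (hy : ∀ k q, Measurable fun ω => y ω k q) (q : ι) :
    Measurable fun ω => sampleMean (y ω) q := by
  simp only [sampleMean, Pi.smul_apply, Finset.sum_apply, smul_eq_mul]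
  exact (Finset.measurable_fun_sum _ fun k _ => hy k q).const_mul _

theorem measurable_sampleCov {ι : Type*} {y : Ω → Fin n → ι → ℝ}
    (hy : ∀ k q, Measurable fun ω => y ω k q) (p q : ι) :
    Measurable fun ω => sampleCov (y ω) p q := by
  simp only [sampleCov, Matrix.smul_apply, Matrix.sum_apply, smul_eq_mul,
    Matrix.vecMulVec_apply, Pi.sub_apply]
  exact (Finset.measurable_fun_sum _ fun k _ => ((hy k p).sub (measurable_sampleMean hy p)).mul
    ((hy k q).sub (measurable_sampleMean hy q))).const_mul _

theorem measurable_matMOfCov {V : Ω → Matrix (Fin d) (Fin d) ℝ}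
    (hV : ∀ j k, Measurable fun ω => V ω j k) (q : UpIdx d) (p : VechIdx d) :
    Measurable fun ω => matMOfCov (V ω) q p := by
  simp only [matMOfCov, matM_apply, vech, vechUp, corrMatrix, Matrix.of_apply, diagPos]
  refine Measurable.mul (measurable_const.sub (measurable_const.mul (Measurable.mul ?_
    measurable_const))) (((hV _ _).mul (hV _ _)).pow_const _)
  exact (hV _ _).div ((hV _ _).mul (hV _ _)).sqrt

theorem measurable_wildSample {y : Ω → Fin n → Fin d → ℝ} {w : Ω → Fin n → ℝ}
    (hy : ∀ k q, Measurable fun ω => y ω k q) (hw : ∀ k, Measurable fun ω => w ω k)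
    (k : Fin n) (q : UpIdx d) : Measurable fun ω => wildSample (y ω) (w ω) k q := by
  have hr : ∀ k p, Measurable fun ω => vechResid (y ω) k p := fun k p =>
    ((hy k p.1.1).sub (measurable_sampleMean hy p.1.1)).mul
      ((hy k p.1.2).sub (measurable_sampleMean hy p.1.2))
  simp only [wildSample, Pi.smul_apply, smul_eq_mul, Matrix.mulVec, dotProduct, Pi.sub_apply]
  exact (hw k).mul (Finset.measurable_fun_sum _ fun p _ =>
    (measurable_matMOfCov (measurable_sampleCov hy) q p).mul
      ((hr k p).sub (measurable_sampleMean hr p)))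

end Measurability

/-! ### Positive semidefiniteness of the limit covariances. -/

section PosSemidef

variable {Ω : Type*} [MeasurableSpace Ω] {d : ℕ} {P : Measure Ω} {e : Ω → Fin d → ℝ}
  {x : ℕ → Fin d → ℝ}

theorem isHermitian_upsilon (P : Measure Ω) (e : Ω → Fin d → ℝ) : (upsilon P e).IsHermitian := by
  have : (covMatrix P fun ω => vech (Matrix.vecMulVec (e ω) (e ω)))ᵀ =
      covMatrix P fun ω => vech (Matrix.vecMulVec (e ω) (e ω)) := by
    ext p q
    exact covariance_comm _ _
  rw [Matrix.IsHermitian, Matrix.conjTranspose_eq_transpose_of_trivial, upsilon,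
    Matrix.transpose_mul, Matrix.transpose_mul, Matrix.transpose_transpose, this, Matrix.mul_assoc]

/-- The quadratic form is a limit of averages of squares along any typical sample. -/
theorem IsTypical.posSemidef_upsilon [IsProbabilityMeasure P] (h : IsTypical P e x)
    (hpos : ∀ j, 0 < covMatrix P e j j) : (upsilon P e).PosSemidef := by
  refine Matrix.PosSemidef.of_dotProduct_mulVec_nonneg (isHermitian_upsilon P e) fun t => ?_
  rw [star_trivial]
  refine ge_of_tendsto' (h.tendsto_cesaro_wildVec_dotProduct_sq hpos t) fun n => ?_
  exact mul_nonneg (by positivity) (Finset.sum_nonneg fun k _ => sq_nonneg _)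

theorem dotProduct_blockDiagonal_mulVec {ι κ : Type*} [Fintype ι] [Fintype κ] [DecidableEq κ]
    (S : κ → Matrix ι ι ℝ) (t : ι × κ → ℝ) :
    t ⬝ᵥ Matrix.blockDiagonal S *ᵥ t =
      ∑ i, (fun q => t (q, i)) ⬝ᵥ S i *ᵥ (fun q => t (q, i)) := by
  simp only [dotProduct, Matrix.mulVec, Fintype.sum_prod_type, Matrix.blockDiagonal_apply,
    ite_mul, zero_mul, Finset.sum_ite_eq, Finset.mem_univ, if_true]
  rw [Finset.sum_comm]

theorem posSemidef_blockDiagonal {ι κ : Type*} [Fintype ι] [Fintype κ] [DecidableEq κ]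
    {S : κ → Matrix ι ι ℝ} (hS : ∀ i, (S i).PosSemidef) :
    (Matrix.blockDiagonal S).PosSemidef := by
  refine Matrix.PosSemidef.of_dotProduct_mulVec_nonneg ?_ fun t => ?_
  · rw [Matrix.IsHermitian, Matrix.blockDiagonal_conjTranspose]
    congr 1
    ext i : 1
    exact (hS i).isHermitian
  · rw [star_trivial, dotProduct_blockDiagonal_mulVec]
    exact Finset.sum_nonneg fun i _ => by
      simpa using (hS i).dotProduct_mulVec_nonneg fun q => t (q, i)

end PosSemidef

/-! ### The central limit theorem with the data held fixed. -/

section WildCLT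

variable {Ω : Type*} [MeasurableSpace Ω] {P : Measure Ω} [IsProbabilityMeasure P] {a d : ℕ}
  {e : Fin a → Ω → Fin d → ℝ} {x : Fin a → ℕ → Fin d → ℝ} {n : ℕ → Fin a → ℕ} {κ : Fin a → ℝ}

theorem tendsto_total_div (hκ_pos : ∀ i, 0 < κ i)
    (hκ : ∀ i, Tendsto (fun m => (n m i : ℝ) / (total (n m) : ℝ)) atTop (𝓝 (κ i))) (i : Fin a) :
    Tendsto (fun m => (total (n m) : ℝ) / (n m i : ℝ)) atTop (𝓝 (κ i)⁻¹) :=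
  ((hκ i).inv₀ (hκ_pos i).ne').congr fun _ => inv_div _ _

/-- Group by group the sum is `N / n i` times an average of squares; the first factor produces `(κ
i)⁻¹`. -/
theorem tendsto_sum_sq_wildVec (hx : ∀ i, IsTypical P (e i) (x i))
    (hpos : ∀ i j, 0 < covMatrix P (e i) j j) (hn : ∀ i, Tendsto (fun m => n m i) atTop atTop)
    (hκ_pos : ∀ i, 0 < κ i)
    (hκ : ∀ i, Tendsto (fun m => (n m i : ℝ) / (total (n m) : ℝ)) atTop (𝓝 (κ i)))
    (I : Finset (Fin a)) (t : Fin a → UpIdx d → ℝ) :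
    Tendsto (fun m => ∑ j ∈ I.sigma fun i => Finset.range (n m i),
      (√(total (n m)) / n m j.1 * (wildVec (x j.1) (n m j.1) j.2 ⬝ᵥ t j.1)) ^ 2) atTop
      (𝓝 (∑ i ∈ I, (κ i)⁻¹ * (t i ⬝ᵥ upsilon P (e i) *ᵥ t i))) := by
  have h := tendsto_finsetSum I fun i _ => (tendsto_total_div hκ_pos hκ i).mul
    (((hx i).tendsto_cesaro_wildVec_dotProduct_sq (hpos i) (t i)).comp (hn i))
  refine h.congr fun m => ?_
  rw [Finset.sum_sigma]
  refine Finset.sum_congr rfl fun i _ => ?_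
  simp only [Function.comp_apply, cesaro, mul_pow, div_pow, ← Finset.mul_sum,
    Real.sq_sqrt (Nat.cast_nonneg _)]
  ring

theorem eventually_abs_wildVec_le (hx : ∀ i, IsTypical P (e i) (x i))
    (hpos : ∀ i j, 0 < covMatrix P (e i) j j) (hn : ∀ i, Tendsto (fun m => n m i) atTop atTop)
    (hκ_pos : ∀ i, 0 < κ i)
    (hκ : ∀ i, Tendsto (fun m => (n m i : ℝ) / (total (n m) : ℝ)) atTop (𝓝 (κ i)))
    (I : Finset (Fin a)) (t : Fin a → UpIdx d → ℝ) {δ : ℝ} (hδ : 0 < δ) :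
    ∀ᶠ m in atTop, ∀ j ∈ I.sigma fun i => Finset.range (n m i),
      |√(total (n m)) / n m j.1 * (wildVec (x j.1) (n m j.1) j.2 ⬝ᵥ t j.1)| ≤ δ := by
  have h : ∀ i, ∀ᶠ m in atTop, ∀ k < n m i,
      |√(total (n m)) / n m i * (wildVec (x i) (n m i) k ⬝ᵥ t i)| ≤ δ := by
    intro i
    -- An eventual bound for `√(N / n i)`, the factor left when `√N / n i` meets an entry of size
    -- `o(√(n i))`.
    set C := √((κ i)⁻¹ + 1)
    have hC0 : 0 < C := Real.sqrt_pos.2 (by have := hκ_pos i; positivity)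
    have h1 : ∀ᶠ m in atTop, (total (n m) : ℝ) / (n m i : ℝ) < (κ i)⁻¹ + 1 :=
      (tendsto_total_div hκ_pos hκ i).eventually_lt_const (by linarith)
    have h2 := (hn i).eventually
      ((hx i).rowNegligible_wildVec_dotProduct (hpos i) (t i) (δ / C) (by positivity))
    filter_upwards [h1, h2] with m h1 h2 k hk
    have hnpos : (0 : ℝ) < n m i := by exact_mod_cast (Nat.zero_le k).trans_lt hk
    rw [abs_mul, abs_of_nonneg (by positivity)]
    calc √(total (n m)) / n m i * |wildVec (x i) (n m i) k ⬝ᵥ t i|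
        ≤ √(total (n m)) / n m i * (δ / C * √(n m i)) := by gcongr; exact h2 k hk
      _ = √((total (n m) : ℝ) / n m i) * (δ / C) := by
          rw [Real.sqrt_div (Nat.cast_nonneg _), div_eq_mul_inv _ √(n m i : ℝ),
            ← Real.sqrt_div_self]
          ring
      _ ≤ C * (δ / C) := by
          gcongr
          exact Real.sqrt_le_sqrt h1.le
      _ = δ := by field_simp
  filter_upwards [eventually_all.2 h] with m hm j hj
  rw [Finset.mem_sigma, Finset.mem_range] at hj
  exact hm j.1 j.2 hj.2

/-- Weak convergence of the resampling distribution along typical samples. -/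
theorem tendsto_integral_wild {ι : Type*} [Fintype ι] [DecidableEq ι]
    (hx : ∀ i, IsTypical P (e i) (x i))
    (hpos : ∀ i j, 0 < covMatrix P (e i) j j) (hn : ∀ i, Tendsto (fun m => n m i) atTop atTop)
    (hκ_pos : ∀ i, 0 < κ i)
    (hκ : ∀ i, Tendsto (fun m => (n m i : ℝ) / (total (n m) : ℝ)) atTop (𝓝 (κ i)))
    {W : Fin a → ℕ → Ω → ℝ} (hW : ∀ i k, Measurable (W i k))
    (hWi : iIndepFun (fun q : Fin a × ℕ => W q.1 q.2) P)
    (hd : ∀ i k, IdentDistrib (W i k) (W i 0) P P) (h0 : ∀ i, ∫ ω, W i 0 ω ∂P = 0)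
    (h1 : ∀ i, ∫ ω, W i 0 ω ^ 2 ∂P = 1)
    (I : Finset (Fin a)) (S : Matrix ι ι ℝ) (hS : S.PosSemidef)
    (v : ℕ → (Σ _ : Fin a, ℕ) → EuclideanSpace ℝ ι)
    (τ : EuclideanSpace ℝ ι → Fin a → UpIdx d → ℝ)
    (hv : ∀ t m, ∀ j ∈ I.sigma fun i => Finset.range (n m i), inner ℝ (v m j) t =
      √(total (n m)) / n m j.1 * (wildVec (x j.1) (n m j.1) j.2 ⬝ᵥ τ t j.1))
    (hτ : ∀ t : EuclideanSpace ℝ ι, ∑ i ∈ I, (κ i)⁻¹ * (τ t i ⬝ᵥ upsilon P (e i) *ᵥ τ t i) =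
      t ⬝ᵥ S *ᵥ t)
    (f : EuclideanSpace ℝ ι →ᵇ ℝ) :
    Tendsto (fun m => ∫ ω, f (∑ j ∈ I.sigma fun i => Finset.range (n m i),
      W j.1 j.2 ω • v m j) ∂P) atTop (𝓝 (∫ y, f y ∂(multivariateGaussian 0 S))) := by
  refine tendsto_integral_sum_smul P (fun j : Σ _ : Fin a, ℕ => W j.1 j.2)
    (fun j => hW j.1 j.2)
    (hWi.precomp (g := fun j : Σ _ : Fin a, ℕ => (j.1, j.2)) ?_) ?_ _ v S hS ?_ ?_ f
  · rintro ⟨i, k⟩ ⟨i', k'⟩ h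
    simp only [Prod.mk.injEq] at h
    obtain ⟨rfl, rfl⟩ := h
    rfl
  · intro η hη
    obtain ⟨δ, hδ, h⟩ := charFun_bound_uniform hW hd h0 h1 hη
    exact ⟨δ, hδ, fun j => h j.1 j.2⟩
  · intro t
    rw [← hτ t]
    refine (tendsto_sum_sq_wildVec hx hpos hn hκ_pos hκ I (τ t)).congr fun m => ?_
    exact Finset.sum_congr rfl fun j hj => by rw [hv t m j hj]
  · intro t δ hδ
    filter_upwards [eventually_abs_wildVec_le hx hpos hn hκ_pos hκ I (τ t) hδ] with m hm j hj
    rw [hv t m j hj]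
    exact hm j hj

/-- Convergence in probability of conditional distributions, for a statistic of the data and of
independent weights, from almost sure convergence with the data held fixed. -/
theorem condTendstoWeakly_of_ae {E F : Type*} [TopologicalSpace E] [MeasurableSpace E]
    [BorelSpace E] [StandardBorelSpace E] [Nonempty E] [MeasurableSpace F]
    {D : ℕ → Type*} [∀ m, MeasurableSpace (D m)] {S : ∀ m, Ω → D m} (hS : ∀ m, Measurable (S m))
    {Z : Ω → F} (hZ : Measurable Z) (hSZ : ∀ m, IndepFun (S m) Z P)
    {Φ : ∀ m, D m × F → E} (hΦ : ∀ m, Measurable (Φ m)) {ν : Measure E}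
    (h : ∀ᵐ ω ∂P, ∀ f : E →ᵇ ℝ, Tendsto (fun m => ∫ ω', f (Φ m (S m ω, Z ω')) ∂P) atTop
      (𝓝 (∫ y, f y ∂ν))) :
    CondTendstoWeakly P S (fun m ω => Φ m (S m ω, Z ω)) ν := by
  intro f
  refine tendstoInMeasure_of_tendsto_ae (fun m => ?_) ?_
  · have : StronglyMeasurable fun x =>
        ∫ y, f y ∂(condDistrib (fun ω => Φ m (S m ω, Z ω)) (S m) P x) :=
      StronglyMeasurable.integral_kernel f.continuous.measurable.stronglyMeasurable
    exact (this.comp_measurable (hS m)).aestronglyMeasurable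
  · have h2 := ae_all_iff.2 fun m =>
      integral_condDistrib_of_indepFun P (S m) Z (hS m) hZ (hSZ m) (Φ m) (hΦ m) f
    filter_upwards [h, h2] with ω hω h2ω
    exact (hω f).congr fun m => (h2ω m).symm

end WildCLT

/-! ### The bootstrap means as weighted sums. -/

section Resampling

variable {Ω : Type*} {a d : ℕ}

theorem wildSample_dataSet (μ : Fin a → Fin d → ℝ) (ε : Fin a → ℕ → Ω → Fin d → ℝ)
    (n : Fin a → ℕ) (i : Fin a) (ω : Ω) (w : ℕ → ℝ) :
    wildSample (dataSet μ ε n ω i) (initial w (n i)) =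
      wildSample (initial (fun k => ε i k ω) (n i)) (initial w (n i)) :=
  wildSample_add_const (μ i) (fun k : Fin (n i) => ε i k ω) _

theorem sampleMean_wildSample_dataSet (μ : Fin a → Fin d → ℝ) (ε : Fin a → ℕ → Ω → Fin d → ℝ)
    (n : Fin a → ℕ) (i : Fin a) (ω : Ω) (w : ℕ → ℝ) (q : UpIdx d) :
    sampleMean (wildSample (dataSet μ ε n ω i) (initial w (n i))) q =
      cesaro (fun k => w k * wildVec (fun k => ε i k ω) (n i) k q) (n i) := by
  rw [wildSample_dataSet, ← sampleMean_initial (fun k q => w k * wildVec _ (n i) k q)]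
  congr 2
  ext k q
  exact wildSample_initial _ w (n i) k q

/-- The statistic `√N Ȳ⋆_i` as a function of the data and the weights. -/
def groupStat (n : Fin a → ℕ) (i : Fin a)
    (z : ((i : Fin a) → Fin (n i) → Fin d → ℝ) × (Fin a × ℕ → ℝ)) : EuclideanSpace ℝ (UpIdx d) :=
  WithLp.toLp 2 (√(total n) • sampleMean (wildSample (z.1 i) (initial (fun k => z.2 (i, k)) (n i))))

/-- The statistic `√N Ȳ⋆` as a function of the data and the weights. -/
def pooledStat (n : Fin a → ℕ)
    (z : ((i : Fin a) → Fin (n i) → Fin d → ℝ) × (Fin a × ℕ → ℝ)) :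
    EuclideanSpace ℝ (UpIdx d × Fin a) :=
  WithLp.toLp 2 fun q => √(total n) *
    sampleMean (wildSample (z.1 q.2) (initial (fun k => z.2 (q.2, k)) (n q.2))) q.1

theorem measurable_sampleMean_wildSample (n : Fin a → ℕ) (i : Fin a) (q : UpIdx d) :
    Measurable fun z : ((i : Fin a) → Fin (n i) → Fin d → ℝ) × (Fin a × ℕ → ℝ) =>
      sampleMean (wildSample (z.1 i) (initial (fun k => z.2 (i, k)) (n i))) q :=
  measurable_sampleMean (measurable_wildSample (fun k q => by fun_prop) fun k => by fun_prop) q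

theorem measurable_groupStat (n : Fin a → ℕ) (i : Fin a) :
    Measurable (groupStat (d := d) n i) :=
  (WithLp.measurable_toLp 2 _).comp <| measurable_pi_lambda _ fun q =>
    (measurable_sampleMean_wildSample n i q).const_mul _

theorem measurable_pooledStat (n : Fin a → ℕ) : Measurable (pooledStat (d := d) n) :=
  (WithLp.measurable_toLp 2 _).comp <| measurable_pi_lambda _ fun q =>
    (measurable_sampleMean_wildSample n q.2 q.1).const_mul _

/-- This is the form weight times fixed vector required by `tendsto_integral_wild`. Summing over the
singleton `{i}` lets one group and all groups share the same index type. -/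
theorem groupStat_dataSet (μ : Fin a → Fin d → ℝ) (ε : Fin a → ℕ → Ω → Fin d → ℝ)
    (n : Fin a → ℕ) (i : Fin a) (ω : Ω) (w : Fin a × ℕ → ℝ) :
    groupStat n i (dataSet μ ε n ω, w) =
      ∑ j ∈ ({i} : Finset (Fin a)).sigma fun i => Finset.range (n i),
        w (j.1, j.2) • (√(total n) / n j.1) •
          WithLp.toLp 2 (wildVec (fun k => ε j.1 k ω) (n j.1) j.2) := by
  ext q
  simp only [groupStat, Finset.sum_sigma, Finset.sum_singleton, WithLp.ofLp_sum,
    Finset.sum_apply, WithLp.ofLp_smul, Pi.smul_apply, smul_eq_mul,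
    sampleMean_wildSample_dataSet, cesaro, Finset.mul_sum]
  exact Finset.sum_congr rfl fun k _ => by ring

theorem pooledStat_dataSet (μ : Fin a → Fin d → ℝ) (ε : Fin a → ℕ → Ω → Fin d → ℝ)
    (n : Fin a → ℕ) (ω : Ω) (w : Fin a × ℕ → ℝ) :
    pooledStat n (dataSet μ ε n ω, w) =
      ∑ j ∈ (Finset.univ : Finset (Fin a)).sigma fun i => Finset.range (n i),
        w (j.1, j.2) • (√(total n) / n j.1) • WithLp.toLp 2 fun q : UpIdx d × Fin a =>
          if q.2 = j.1 then wildVec (fun k => ε j.1 k ω) (n j.1) j.2 q.1 else 0 := by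
  ext q
  simp only [pooledStat, Finset.sum_sigma, WithLp.ofLp_sum,
    Finset.sum_apply, WithLp.ofLp_smul, Pi.smul_apply, smul_eq_mul,
    sampleMean_wildSample_dataSet, cesaro, Finset.mul_sum]
  -- A coordinate in block `q.2` receives contributions from that group only.
  rw [Finset.sum_eq_single q.2 (fun i _ hi => by simp [hi.symm]) (by simp)]
  exact Finset.sum_congr rfl fun k _ => by rw [if_pos rfl]; ring

end Resampling

end WildBootstrap

end

/-! ### The main theorem. -/

open WildBootstrap in
theorem mainTheorem5 {Ω : Type*} [MeasurableSpace Ω] (P : Measure Ω) [IsProbabilityMeasure P]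
    (a d : ℕ) (hd : 2 ≤ d)
    (μ : Fin a → Fin d → ℝ) (ε : Fin a → ℕ → Ω → Fin d → ℝ) (W : Fin a → ℕ → Ω → ℝ)
    -- the residuals: independent, i.i.d. within each group, centred, finite fourth moments,
    -- positive variances
    (hε_meas : ∀ i k, Measurable (ε i k))
    (hε_indep : iIndepFun (fun q : Fin a × ℕ => ε q.1 q.2) P)
    (hε_ident : ∀ i k, IdentDistrib (ε i k) (ε i 0) P P)
    (hε_mean : ∀ i, ∫ ω, ε i 0 ω ∂P = 0)
    (hε_four : ∀ i, Integrable (fun ω => ‖(WithLp.toLp 2 (ε i 0 ω) : EuclideanSpace ℝ (Fin d))‖ ^ 4) P)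
    (hε_var : ∀ i j, 0 < WildBootstrap.covMatrix P (ε i 0) j j)
    -- the bootstrap weights: independent, i.i.d. within each group, mean 0 and variance 1,
    -- independent of the data
    (hW_meas : ∀ i k, Measurable (W i k))
    (hW_indep : iIndepFun (fun q : Fin a × ℕ => W q.1 q.2) P)
    (hW_ident : ∀ i k, IdentDistrib (W i k) (W i 0) P P)
    (hW_mean : ∀ i, ∫ ω, W i 0 ω ∂P = 0)
    (hW_var : ∀ i, Var[W i 0; P] = 1)
    (hεW : IndepFun (fun ω (q : Fin a × ℕ) => ε q.1 q.2 ω) (fun ω (q : Fin a × ℕ) => W q.1 q.2 ω) P)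
    -- the sample sizes `n m 1, …, n m a` at stage `m`, and their limiting proportions
    (n : ℕ → Fin a → ℕ) (κ : Fin a → ℝ)
    (hn : ∀ i, Tendsto (fun m => n m i) atTop atTop)
    (hκ_pos : ∀ i, 0 < κ i)
    (hκ : ∀ i, Tendsto (fun m => (n m i : ℝ) / (WildBootstrap.total (n m) : ℝ)) atTop (𝓝 (κ i))) :
    (∀ i, WildBootstrap.CondTendstoWeakly P
        (fun m => WildBootstrap.dataSet μ ε (n m))
        (fun m => WildBootstrap.scaledGroupMean μ ε W (n m) i)
        (multivariateGaussian 0 ((κ i)⁻¹ • WildBootstrap.upsilon P (ε i 0)))) ∧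
    WildBootstrap.CondTendstoWeakly P
        (fun m => WildBootstrap.dataSet μ ε (n m))
        (fun m => WildBootstrap.scaledPooledMean μ ε W (n m))
        (multivariateGaussian 0 (WildBootstrap.upsilonPooled P ε κ)) ∧
    (∀ i p q, TendstoInMeasure P
        (fun m ω => WildBootstrap.upsilonStar μ ε W (n m) i ω p q) atTop
        (fun _ => WildBootstrap.upsilon P (ε i 0) p q)) ∧
    (∀ p q, TendstoInMeasure P
        (fun m ω => WildBootstrap.upsilonStarPooled μ ε W (n m) ω p q) atTop
        (fun _ => WildBootstrap.upsilonPooled P ε κ p q)) := by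
  have hdata : ∀ m, Measurable (dataSet μ ε (n m)) := fun m =>
    measurable_pi_lambda _ fun i => measurable_pi_lambda _ fun k => (hε_meas i k).const_add (μ i)
  have hZ : Measurable fun ω (q : Fin a × ℕ) => W q.1 q.2 ω :=
    measurable_pi_lambda _ fun q => hW_meas q.1 q.2
  have hSZ : ∀ m, IndepFun (dataSet μ ε (n m)) (fun ω (q : Fin a × ℕ) => W q.1 q.2 ω) P := by
    intro m
    have hφ : Measurable fun (x : Fin a × ℕ → Fin d → ℝ) (i : Fin a) (k : Fin (n m i)) =>
        μ i + x (i, (k : ℕ)) := by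
      fun_prop
    exact hεW.comp hφ measurable_id
  -- A variable with infinite second moment has variance `0` by convention, so variance `1` forces
  -- square integrability.
  have hW_memLp : ∀ i, MemLp (W i 0) 2 P := fun i =>
    memLp_two_of_variance_ne_zero (hW_meas i 0).aestronglyMeasurable (by simp [hW_var])
  have hW_sq : ∀ i, ∫ ω, W i 0 ω ^ 2 ∂P = 1 := fun i => by
    have := variance_of_integral_eq_zero (hW_meas i 0).aemeasurable (hW_mean i)
    rw [← this, hW_var]
  have hinj : ∀ i : Fin a, Function.Injective fun k : ℕ => (i, k) := fun i k l h => by simpa using h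
  have hεi : ∀ i, iIndepFun (ε i) P := fun i => iIndepFun.precomp (g := fun k => (i, k)) (hinj i) hε_indep
  have hWi : ∀ i, iIndepFun (W i) P := fun i => iIndepFun.precomp (g := fun k => (i, k)) (hinj i) hW_indep
  have hεWi : ∀ i, IndepFun (fun ω k => ε i k ω) (fun ω k => W i k ω) P := by
    intro i
    have hφ : Measurable fun (x : Fin a × ℕ → Fin d → ℝ) (k : ℕ) => x (i, k) := by fun_prop
    have hψ : Measurable fun (x : Fin a × ℕ → ℝ) (k : ℕ) => x (i, k) := by fun_prop
    exact hεW.comp hφ hψ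
  have htyp : ∀ᵐ ω ∂P, ∀ i, IsTypical P (ε i 0) (fun k => ε i k ω) := ae_all_iff.2 fun i =>
    ae_isTypical (hε_meas i) (hW_meas i) (hεi i) (hWi i) (hε_ident i) (hW_ident i) (hεWi i)
      (hε_four i) (hε_mean i)
  have hlln1 : ∀ i, ∀ᵐ ω ∂P, MomentLLN P (ε i 0) (fun k => ε i k ω) (fun k => W i k ω) 0 := by
    intro i
    have := ae_momentLLN (hε_meas i) (hW_meas i) (hεi i) (hWi i) (hε_ident i) (hW_ident i)
      (hεWi i) (hε_four i) id measurable_id ((hW_memLp i).integrable one_le_two)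
    simpa [hW_mean] using this
  have hlln2 : ∀ i, ∀ᵐ ω ∂P,
      MomentLLN P (ε i 0) (fun k => ε i k ω) (fun k => W i k ω ^ 2) 1 := by
    intro i
    have := ae_momentLLN (hε_meas i) (hW_meas i) (hεi i) (hWi i) (hε_ident i) (hW_ident i)
      (hεWi i) (hε_four i) (fun w => w ^ 2) (by fun_prop) (hW_memLp i).integrable_sq
    simpa [hW_sq] using this
  -- The limit matrices are not random, so one typical sample suffices for their positive
  -- semidefiniteness.
  obtain ⟨ω₀, hω₀⟩ := htyp.exists
  have hpsd : ∀ i, ((κ i)⁻¹ • upsilon P (ε i 0)).PosSemidef := fun i =>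
    ((hω₀ i).posSemidef_upsilon (hε_var i)).smul (inv_nonneg.2 (hκ_pos i).le)
  have hconv : ∀ i q r, ∀ᵐ ω ∂P, Tendsto (fun m => upsilonStar μ ε W (n m) i ω q r) atTop
      (𝓝 (upsilon P (ε i 0) q r)) := by
    intro i q r
    filter_upwards [htyp, hlln1 i, hlln2 i] with ω h h1 h2
    have := ((h i).tendsto_sampleCov_wildSample (hε_var i) h1 h2 q r).comp (hn i)
    rw [one_mul] at this
    refine this.congr fun m => ?_
    exact congrArg (fun y => sampleCov y q r)
      (wildSample_dataSet μ ε (n m) i ω fun k => W i k ω).symm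
  have hmeas : ∀ m i q r, Measurable fun ω => upsilonStar μ ε W (n m) i ω q r := fun m i =>
    measurable_sampleCov (measurable_wildSample
      (fun k q => (measurable_pi_apply q).comp ((hε_meas i k).const_add (μ i)))
      fun k => hW_meas i k)
  refine ⟨fun i => ?_, ?_, fun i q r => ?_, fun q r => ?_⟩
  -- `scaledGroupMean` unfolds to `groupStat` evaluated at the data and the full family of weights.
  · refine condTendstoWeakly_of_ae hdata hZ hSZ (fun m => measurable_groupStat (n m) i) ?_
    filter_upwards [htyp] with ω hω f
    simp_rw [groupStat_dataSet]
    refine tendsto_integral_wild hω hε_var hn hκ_pos hκ hW_meas hW_indep hW_ident hW_mean hW_sq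
      {i} _ (hpsd i) _ (fun t _ => t) (fun t m j _ => ?_) (fun t => ?_) f
    · rw [inner_smul_left, EuclideanSpace.inner_eq_star_dotProduct, dotProduct_comm]
      simp
    · simp [Matrix.smul_mulVec]
  · refine condTendstoWeakly_of_ae hdata hZ hSZ (fun m => measurable_pooledStat (n m)) ?_
    filter_upwards [htyp] with ω hω f
    simp_rw [pooledStat_dataSet]
    -- The direction `t` is restricted to block `i`, matching coefficient vectors supported in a
    -- single block; the block-diagonal quadratic form then splits over the groups.
    refine tendsto_integral_wild hω hε_var hn hκ_pos hκ hW_meas hW_indep hW_ident hW_mean hW_sq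
      Finset.univ _ (posSemidef_blockDiagonal hpsd) _ (fun t i q => t (q, i)) (fun t m j _ => ?_)
      (fun t => ?_) f
    · rw [inner_smul_left, EuclideanSpace.inner_eq_star_dotProduct, dotProduct_comm]
      simp [dotProduct, Fintype.sum_prod_type]
    · rw [dotProduct_blockDiagonal_mulVec]
      simp [Matrix.smul_mulVec]
  · exact tendstoInMeasure_of_tendsto_ae (fun m => (hmeas m i q r).aestronglyMeasurable)
      (hconv i q r)
  · refine tendstoInMeasure_of_tendsto_ae (fun m => Measurable.aestronglyMeasurable ?_) ?_
    · simp only [upsilonStarPooled, Matrix.blockDiagonal_apply]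
      split_ifs
      · exact (hmeas m _ _ _).const_mul _
      · exact measurable_const
    · filter_upwards [hconv q.2 q.1 r.1] with ω hω
      simp only [upsilonStarPooled, upsilonPooled, Matrix.blockDiagonal_apply]
      split_ifs
      · exact (tendsto_total_div hκ_pos hκ q.2).mul hω
      · exact tendsto_const_nhds
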